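/- For a transcendental entire function $f$, the Fatou set $\mathcal F(f)$ is the set of points of $\mathbb C$ having a neighbourhood on which the iterates $f^n$, $n>0$, form a normal family with respect to the spherical metric, and a Fatou component is a connected component of $\mathcal F(f)$. For a Fatou component $U$ let $U_n$ be the Fatou component containing $f^n(U)$; $U$ is periodic if $U_p=U$ for some $p\ge 1$, preperiodic if it is not periodic but some $U_k$, $k\geq 1$, is periodic, and a wandering domain otherwise. A wandering domain $W$ is a Baker wandering domain if every $W_n$ is bounded, there is $N$ such that for all $n\ge N$ the set $W_{n+1}$ surrounds $W_n$ and $0$ (each lies in a bounded component of $\widehat{\mathbb C}\setminus W_{n+1}$), and $\operatorname{dist}(W_n,0)\to\infty$ as $n\to\infty$. Let $0<\lambda<2$, let $f_\lambda(z)=\lambda e^z+z+\lambda$ and $F_\lambda(z)=f_\lambda(z)+2\pi i$. For $k\in\mathbb Z$ let $\mathcal A((2k+1)\pi i)$ be the immediate basin of attraction of the fixed point $(2k+1)\pi i$ of $f_\lambda$, that is, the connected component containing $(2k+1)\pi i$ of the set $\{z : f_\lambda^n(z)\to(2k+1)\pi i\}$. Then for every $k\in\mathbb Z$ the set $\mathcal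 A((2k+1)\pi i)$ is a wandering domain of $F_\lambda$; it is simply connected, unbounded and escaping, i.e. $F_\lambda^n(z)\to\infty$ as $n\to\infty$ for each of its points $z$. Moreover, $F_\lambda$ has no Baker wandering domain. -/

import Mathlib

open Set Filter Topology

/-- The uniform structure of the Riemann sphere `ℂ ∪ {∞}`. A compact Hausdorff space carries
exactly one uniform structure that induces its topology, so this is the one of the chordal
(spherical) metric. -/
noncomputable instance riemannSphereUniformSpace : UniformSpace (OnePoint ℂ) :=
  uniformSpaceOfCompactR1

namespace EntireDynamics

/-- A family of maps into the Riemann sphere is normal on `U`: every sequence of members has a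
subsequence that converges locally uniformly on `U` with respect to the spherical metric (the
limit may take the value `∞`). -/
def NormalOn {ι : Type*} (F : ι → ℂ → OnePoint ℂ) (U : Set ℂ) : Prop :=
  ∀ φ : ℕ → ι, ∃ ψ : ℕ → ℕ, StrictMono ψ ∧ ∃ g : ℂ → OnePoint ℂ,
    TendstoLocallyUniformlyOn (fun j => F (φ (ψ j))) g atTop U

/-- The Fatou set of a (transcendental) entire function: the points that have a neighbourhood on
which the iterates `f^n`, `n > 0`, form a normal family. The point `∞` never belongs to the
Fatou set of a transcendental entire function, as the iterates are not defined there. -/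
def fatouSet (f : ℂ → ℂ) : Set ℂ :=
  {z | ∃ U : Set ℂ, IsOpen U ∧ z ∈ U ∧
    NormalOn (fun (n : ℕ) (w : ℂ) => ((f^[n + 1] w : ℂ) : OnePoint ℂ)) U}

/-- A Fatou component: a connected component of the Fatou set. -/
def IsFatouComponent (f : ℂ → ℂ) (U : Set ℂ) : Prop :=
  ∃ z ∈ fatouSet f, U = connectedComponentIn (fatouSet f) z

/-- `V` is the Fatou component `U_n` that contains `f^n(U)`. -/
def IsIterateComponent (f : ℂ → ℂ) (U : Set ℂ) (n : ℕ) (V : Set ℂ) : Prop :=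
  IsFatouComponent f V ∧ f^[n] '' U ⊆ V

/-- `U_p = U` for some `p ≥ 1`. -/
def IsPeriodicComponent (f : ℂ → ℂ) (U : Set ℂ) : Prop :=
  IsFatouComponent f U ∧ ∃ p : ℕ, 0 < p ∧ IsIterateComponent f U p U

/-- `U` is not periodic, but `U_k` is periodic for some `k ≥ 1`. -/
def IsPreperiodicComponent (f : ℂ → ℂ) (U : Set ℂ) : Prop :=
  IsFatouComponent f U ∧ ¬ IsPeriodicComponent f U ∧
    ∃ k : ℕ, 0 < k ∧ ∃ V : Set ℂ, IsIterateComponent f U k V ∧ IsPeriodicComponent f V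

/-- A wandering domain: a Fatou component that is neither periodic nor preperiodic. -/
def IsWanderingDomain (f : ℂ → ℂ) (U : Set ℂ) : Prop :=
  IsFatouComponent f U ∧ ¬ IsPeriodicComponent f U ∧ ¬ IsPreperiodicComponent f U

/-- `W` surrounds `S`: some bounded connected component `C` of the complement of `W` in the
Riemann sphere contains `S`. -/
def Surrounds (W S : Set ℂ) : Prop :=
  ∃ C : Set ℂ, Bornology.IsBounded C ∧
    (∃ z ∈ C, ((↑) '' C : Set (OnePoint ℂ)) =
      connectedComponentIn ((↑) '' W : Set (OnePoint ℂ))ᶜ (z : OnePoint ℂ)) ∧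
    S ⊆ C

/-- A Baker wandering domain: a wandering domain `D` such that each `D_n` is bounded, `D_{n+1}`
surrounds both `D_n` and `0` for all large `n`, and `dist(D_n, 0) → ∞`. -/
def IsBakerWanderingDomain (f : ℂ → ℂ) (D : Set ℂ) : Prop :=
  IsWanderingDomain f D ∧ ∃ W : ℕ → Set ℂ, (∀ n, IsIterateComponent f D n (W n)) ∧
    (∀ n, Bornology.IsBounded (W n)) ∧
    (∃ N : ℕ, ∀ n ≥ N, Surrounds (W (n + 1)) (W n) ∧ Surrounds (W (n + 1)) {0}) ∧
    Tendsto (fun n => Metric.infDist 0 (W n)) atTop atTop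

/-- The immediate basin of attraction of a fixed point `p`: the connected component containing
`p` of the set of points whose orbits converge to `p`. -/
def immediateBasin (f : ℂ → ℂ) (p : ℂ) : Set ℂ :=
  connectedComponentIn {z | Tendsto (fun n : ℕ => f^[n] z) atTop (𝓝 p)} p

/-- All orbits that start in `U` tend to `∞`. -/
def IsEscaping (f : ℂ → ℂ) (U : Set ℂ) : Prop :=
  ∀ z ∈ U, Tendsto (fun n : ℕ => f^[n] z) atTop (Bornology.cobounded ℂ)

/-- `f_λ(z) = λ e^z + z + λ`. -/
noncomputable def fMap (l : ℝ) (z : ℂ) : ℂ := l * Complex.exp z + z + l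

/-- `F_λ(z) = f_λ(z) + 2πi = λ e^z + z + λ + 2πi`. -/
noncomputable def FMap (l : ℝ) (z : ℂ) : ℂ := fMap l z + 2 * Real.pi * Complex.I

end EntireDynamics

/-!
Why the theorem is true. Put `z = (2k+1)πi + ζ`. Since `exp((2k+1)πi) = -1`, the map `f_λ` becomes
`g(ζ) = ζ + λ - λe^ζ` (`centredMap`) for every `k`, and `F_λ^n(z) = (2(k+n)+1)πi + g^n(ζ)`
(`iterate_FMap_fixedPt_add`). So everything reduces to the immediate basin `A` of the attracting
fixed point `0` of `g`, whose multiplier is `1 - λ ∈ (-1, 1)`. The lines `Im ζ = ±π` consist of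
points that escape under `g`, hence `A` lies in the strip `|Im ζ| < π`
(`centredImmediateBasin_subset_strip`). It contains the negative real axis, because
`|1 - e^x|` is a strict Lyapunov function there (`abs_one_sub_mul_exp_sub_one_lt`); so it is
unbounded.

*Fatou component.* On the translates of `A` the iterates of `F_λ` tend to `∞` locally uniformly, so
these lie in the Fatou set. Let `ζ₀` be a boundary point of `A` and suppose that its translate is
in the Fatou set. A spherical limit of iterates of `F_λ` near this point is `∞` on a translate of
`A`, hence identically `∞`, so that the iterates are eventually at least `1` in modulus and
`log |F_λ^n|` obeys Harnack's inequality (`log_norm_le_of_one_le_norm`). But near `ζ₀` there are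
points of `A`, whose orbits under `F_λ` grow linearly, and, by the Schwarz lemma
(`exists_abs_im_iterate_eq_pi`), points whose orbits under `g` reach a line `Im ζ = ±π`, after which
the real part grows at least exponentially. This contradiction shows that `A` translates to a Fatou
component (`image_eq_connectedComponentIn_fatouSet`). As `F_λ` moves the fixed points
`(2k+1)πi` to each other, these components are wandering and escaping.

*Simple connectivity.* The map `g` is a double cover of the strip `S` by `S ∩ g⁻¹(S)`, branched over
a single critical value `v`: a holomorphic branch of `√(g - v)` maps the strip univalently
(`injOn_sqrtMap`) onto a domain that contains every `u` with `u² + v ∈ S` (`exists_sqrtMap_eq`).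
The reason is that `g` maps the upper half of the strip injectively, with `(-∞, v]` omitted from
the image and every other point of `S` attained; along a level line of `Im g` the real part of `g`
is strictly increasing in `Im ζ` (`strictMonoOn_heightFun`). Consequently pulling back a conformal
disc gives a conformal disc (`IsConformalDisc.connectedComponentIn_preimage`), and `A` is the
increasing union of the successive pull-backs of a small disc at `0` (`iUnion_basinExhaustion`).

*No Baker wandering domains.* A Fatou component that surrounds `0` at a distance greater than `π`
either meets the unbounded connected set formed by a disc and the component of `πi`, hence is equal
to this unbounded component, or has that set in one of its bounded complementary components; both
are impossible (`not_isBakerWanderingDomain_FMap`).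
-/

namespace EntireDynamics

/-! ### The map near a fixed point -/

/-- The map `f_λ` in the coordinate centred at any of the fixed points `(2k+1)πi`; as
`exp((2k+1)πi) = -1`, it does not depend on `k`. -/
noncomputable def centredMap (l : ℝ) (z : ℂ) : ℂ := z + l - l * Complex.exp z

/-- The fixed point `(2k+1)πi` of `f_λ`. -/
noncomputable def fixedPt (k : ℤ) : ℂ := (2 * k + 1) * Real.pi * Complex.I

/-- The basin of attraction of the fixed point `0` of the centred map. -/
def centredBasin (l : ℝ) : Set ℂ := {z | Tendsto (fun n : ℕ => (centredMap l)^[n] z) atTop (𝓝 0)}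

/-- The strip `|Im z| < π`. -/
def strip : Set ℂ := {z | |z.im| < Real.pi}

lemma isOpen_strip : IsOpen strip :=
  isOpen_lt (Complex.continuous_im.abs) continuous_const

lemma zero_mem_strip : (0 : ℂ) ∈ strip := by simp [strip, Real.pi_pos]

@[simp] lemma centredMap_zero (l : ℝ) : centredMap l 0 = 0 := by simp [centredMap]

lemma differentiable_centredMap (l : ℝ) : Differentiable ℂ (centredMap l) := by
  unfold centredMap; fun_prop

lemma continuous_centredMap (l : ℝ) : Continuous (centredMap l) :=
  (differentiable_centredMap l).continuous

lemma hasDerivAt_centredMap (l : ℝ) (z : ℂ) :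
    HasDerivAt (centredMap l) (1 - l * Complex.exp z) z := by
  unfold centredMap
  exact ((hasDerivAt_id z).add_const _).sub ((Complex.hasDerivAt_exp z).const_mul _)

lemma differentiable_iterate_centredMap (l : ℝ) (n : ℕ) : Differentiable ℂ (centredMap l)^[n] :=
  (differentiable_centredMap l).iterate n

lemma continuous_iterate_centredMap (l : ℝ) (n : ℕ) : Continuous (centredMap l)^[n] :=
  (continuous_centredMap l).iterate n

lemma centredMap_re (l : ℝ) (z : ℂ) :
    (centredMap l z).re = z.re + l - l * (Real.exp z.re * Real.cos z.im) := by
  simp [centredMap, Complex.exp_re]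

lemma centredMap_im (l : ℝ) (z : ℂ) :
    (centredMap l z).im = z.im - l * (Real.exp z.re * Real.sin z.im) := by
  simp [centredMap, Complex.exp_im]

lemma centredMap_ofReal (l x : ℝ) :
    centredMap l (x : ℂ) = ((x + l - l * Real.exp x : ℝ) : ℂ) := by
  simp [centredMap]

lemma centredMap_conj (l : ℝ) (z : ℂ) :
    centredMap l (starRingEnd ℂ z) = starRingEnd ℂ (centredMap l z) := by
  simp [centredMap, Complex.exp_conj]

lemma exp_fixedPt (k : ℤ) : Complex.exp (fixedPt k) = -1 := by
  have : fixedPt k = Real.pi * Complex.I + k * (2 * Real.pi * Complex.I) := by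
    unfold fixedPt; ring
  rw [this, Complex.exp_add, Complex.exp_int_mul_two_pi_mul_I, Complex.exp_pi_mul_I, mul_one]

lemma fMap_fixedPt_add (l : ℝ) (k : ℤ) (z : ℂ) :
    fMap l (fixedPt k + z) = fixedPt k + centredMap l z := by
  simp only [fMap, centredMap, Complex.exp_add, exp_fixedPt]; ring

lemma iterate_fMap_fixedPt_add (l : ℝ) (k : ℤ) (n : ℕ) (z : ℂ) :
    (fMap l)^[n] (fixedPt k + z) = fixedPt k + (centredMap l)^[n] z := by
  induction n with
  | zero => rfl
  | succ n ih => rw [Function.iterate_succ_apply', ih, fMap_fixedPt_add,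
      Function.iterate_succ_apply']

lemma fixedPt_add (k : ℤ) (n : ℕ) :
    fixedPt (k + n) = fixedPt k + n * (2 * Real.pi * Complex.I) := by
  unfold fixedPt; push_cast; ring

lemma FMap_fixedPt_add (l : ℝ) (k : ℤ) (z : ℂ) :
    FMap l (fixedPt k + z) = fixedPt (k + 1) + centredMap l z := by
  have := fixedPt_add k 1
  push_cast at this
  rw [FMap, fMap_fixedPt_add, this]; ring

/-- In the coordinate centred at a fixed point of `f_λ`, the map `F_λ` is the same map with the
fixed point moved up by `2πi`. -/
lemma iterate_FMap_fixedPt_add (l : ℝ) (k : ℤ) (n : ℕ) (z : ℂ) :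
    (FMap l)^[n] (fixedPt k + z) = fixedPt (k + n) + (centredMap l)^[n] z := by
  induction n with
  | zero => simp
  | succ n ih =>
    rw [Function.iterate_succ_apply', ih, FMap_fixedPt_add, Function.iterate_succ_apply']
    push_cast; ring_nf

/-- The immediate basin of `0` under the centred map. -/
def centredImmediateBasin (l : ℝ) : Set ℂ := immediateBasin (centredMap l) 0

lemma immediateBasin_fMap (l : ℝ) (k : ℤ) :
    immediateBasin (fMap l) (fixedPt k) = (fixedPt k + ·) '' centredImmediateBasin l := by
  have h0 : (0 : ℂ) ∈ {z | Tendsto (fun n : ℕ => (centredMap l)^[n] z) atTop (𝓝 0)} := by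
    simp [Function.iterate_fixed (centredMap_zero l)]
  have := (Homeomorph.addLeft (fixedPt k)).image_connectedComponentIn h0
  simp only [Homeomorph.coe_addLeft, add_zero] at this
  rw [centredImmediateBasin, immediateBasin, immediateBasin, this]
  congr 1
  ext z
  simp only [mem_ofPred_eq, mem_image]
  constructor
  · intro h
    refine ⟨z - fixedPt k, ?_, by ring⟩
    have h2 := h.sub_const (fixedPt k)
    rw [sub_self] at h2
    refine h2.congr fun n => ?_
    have := iterate_fMap_fixedPt_add l k n (z - fixedPt k)
    rw [add_sub_cancel] at this
    rw [this]; ring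
  · rintro ⟨w, hw, rfl⟩
    simp only [iterate_fMap_fixedPt_add]
    simpa using hw.const_add (fixedPt k)

/-! ### The immediate basin -/

/-- The centred map is a contraction towards `0` near `0`. -/
lemma exists_contracting_ball {l : ℝ} (hl0 : 0 < l) (hl2 : l < 2) :
    ∃ q r : ℝ, 0 ≤ q ∧ q < 1 ∧ 0 < r ∧ r < Real.pi ∧
      ∀ z ∈ Metric.ball (0 : ℂ) r, ‖centredMap l z‖ ≤ q * ‖z‖ := by
  have hd := hasDerivAt_centredMap l 0
  have hlt : ‖(1 - l * Complex.exp 0 : ℂ)‖ < 1 := by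
    rw [Complex.exp_zero, mul_one, ← Complex.ofReal_one, ← Complex.ofReal_sub, Complex.norm_real,
      Real.norm_eq_abs, abs_lt]
    constructor <;> linarith
  obtain ⟨q, hq, hq1⟩ := exists_between hlt
  have h1 := hd.hasFDerivAt.isLittleO
  have h2 := h1.def (sub_pos.2 hq)
  rw [Metric.eventually_nhds_iff_ball] at h2
  obtain ⟨r, hr, h2⟩ := h2
  refine ⟨q, min r 1, (norm_nonneg _).trans hq.le, hq1, by positivity,
    (min_le_right _ _).trans_lt (by linarith [Real.pi_gt_three]), fun z hz => ?_⟩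
  have h3 := h2 z (Metric.ball_subset_ball (min_le_left _ _) hz)
  simp only [sub_zero, centredMap_zero] at h3
  have h4 : ‖z • (1 - l * Complex.exp 0 : ℂ)‖ = ‖(1 - l * Complex.exp 0 : ℂ)‖ * ‖z‖ := by
    rw [norm_smul, mul_comm]
  have h5 := norm_sub_norm_le (centredMap l z) (z • (1 - l * Complex.exp 0 : ℂ))
  have h6 : ‖centredMap l z - z • (1 - l * Complex.exp 0 : ℂ)‖
      ≤ (q - ‖(1 - l * Complex.exp 0 : ℂ)‖) * ‖z‖ := by simpa using h3
  nlinarith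

lemma mapsTo_ball_of_contracting {l q r : ℝ} (hq1 : q < 1)
    (h : ∀ z ∈ Metric.ball (0 : ℂ) r, ‖centredMap l z‖ ≤ q * ‖z‖) :
    MapsTo (centredMap l) (Metric.ball 0 r) (Metric.ball 0 r) := by
  intro z hz
  have := h z hz
  rw [mem_ball_zero_iff] at hz ⊢
  nlinarith [norm_nonneg z]

lemma ball_subset_centredBasin {l q r : ℝ} (hq0 : 0 ≤ q) (hq1 : q < 1)
    (h : ∀ z ∈ Metric.ball (0 : ℂ) r, ‖centredMap l z‖ ≤ q * ‖z‖) :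
    Metric.ball 0 r ⊆ centredBasin l := by
  intro z hz
  have hm := mapsTo_ball_of_contracting hq1 h
  have hb : ∀ n : ℕ, ‖(centredMap l)^[n] z‖ ≤ q ^ n * ‖z‖ := by
    intro n
    induction n with
    | zero => simp
    | succ n ih =>
      rw [Function.iterate_succ_apply', pow_succ']
      calc _ ≤ q * ‖(centredMap l)^[n] z‖ := h _ (hm.iterate n hz)
        _ ≤ q * (q ^ n * ‖z‖) := by gcongr
        _ = _ := by ring
  refine squeeze_zero_norm hb ?_
  simpa using (tendsto_pow_atTop_nhds_zero_of_lt_one hq0 hq1).mul_const ‖z‖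

lemma mem_centredBasin_of_iterate_mem {l : ℝ} {z : ℂ} (n : ℕ)
    (h : (centredMap l)^[n] z ∈ centredBasin l) : z ∈ centredBasin l := by
  have h' : Tendsto (fun m : ℕ => (centredMap l)^[m] ((centredMap l)^[n] z)) atTop (𝓝 0) := h
  simp only [← Function.iterate_add_apply] at h'
  exact (tendsto_add_atTop_iff_nat (f := fun m : ℕ => (centredMap l)^[m] z) n).1 h'

lemma iterate_mem_centredBasin {l : ℝ} {z : ℂ} (n : ℕ) (h : z ∈ centredBasin l) :
    (centredMap l)^[n] z ∈ centredBasin l := by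
  have h' := (tendsto_add_atTop_iff_nat (f := fun m : ℕ => (centredMap l)^[m] z) n).2 h
  simp only [Function.iterate_add_apply] at h'
  exact h'

lemma exists_iterate_mem_ball {l r : ℝ} (hr : 0 < r) {z : ℂ} (h : z ∈ centredBasin l) :
    ∃ n, (centredMap l)^[n] z ∈ Metric.ball (0 : ℂ) r :=
  ((h : Tendsto _ _ _).eventually (Metric.ball_mem_nhds 0 hr)).exists

lemma isOpen_centredBasin {l : ℝ} (hl0 : 0 < l) (hl2 : l < 2) : IsOpen (centredBasin l) := by
  obtain ⟨q, r, hq0, hq1, hr, -, h⟩ := exists_contracting_ball hl0 hl2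
  have : centredBasin l = ⋃ n : ℕ, (centredMap l)^[n] ⁻¹' Metric.ball 0 r := by
    ext z
    simp only [mem_iUnion, mem_preimage]
    exact ⟨exists_iterate_mem_ball hr, fun ⟨n, hn⟩ =>
      mem_centredBasin_of_iterate_mem n (ball_subset_centredBasin hq0 hq1 h hn)⟩
  rw [this]
  exact isOpen_iUnion fun n => Metric.isOpen_ball.preimage (continuous_iterate_centredMap l n)

lemma zero_mem_centredBasin (l : ℝ) : (0 : ℂ) ∈ centredBasin l := by
  simp [centredBasin, Function.iterate_fixed (centredMap_zero l)]

lemma centredImmediateBasin_def (l : ℝ) :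
    centredImmediateBasin l = connectedComponentIn (centredBasin l) 0 := rfl

lemma zero_mem_centredImmediateBasin (l : ℝ) : (0 : ℂ) ∈ centredImmediateBasin l :=
  mem_connectedComponentIn (zero_mem_centredBasin l)

lemma centredImmediateBasin_subset (l : ℝ) : centredImmediateBasin l ⊆ centredBasin l :=
  connectedComponentIn_subset _ _

lemma isPreconnected_centredImmediateBasin (l : ℝ) : IsPreconnected (centredImmediateBasin l) :=
  isPreconnected_connectedComponentIn

lemma isOpen_centredImmediateBasin {l : ℝ} (hl0 : 0 < l) (hl2 : l < 2) :
    IsOpen (centredImmediateBasin l) :=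
  (isOpen_centredBasin hl0 hl2).connectedComponentIn

lemma subset_centredImmediateBasin {l : ℝ} {S : Set ℂ} (hS : IsPreconnected S) (h0 : (0 : ℂ) ∈ S)
    (h : S ⊆ centredBasin l) : S ⊆ centredImmediateBasin l :=
  hS.subset_connectedComponentIn h0 h

lemma mapsTo_centredImmediateBasin (l : ℝ) :
    MapsTo (centredMap l) (centredImmediateBasin l) (centredImmediateBasin l) := by
  rw [mapsTo_iff_image_subset]
  refine subset_centredImmediateBasin
    ((isPreconnected_centredImmediateBasin l).image _ (continuous_centredMap l).continuousOn)
    ⟨0, zero_mem_centredImmediateBasin l, centredMap_zero l⟩ ?_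
  rintro _ ⟨z, hz, rfl⟩
  exact iterate_mem_centredBasin 1 (centredImmediateBasin_subset l hz)

/-- The immediate basin is relatively closed in the basin. -/
lemma closure_inter_centredBasin_subset {l : ℝ} (hl0 : 0 < l) (hl2 : l < 2) {z : ℂ}
    (hz : z ∈ closure (centredImmediateBasin l)) (hb : z ∈ centredBasin l) :
    z ∈ centredImmediateBasin l := by
  have ho : IsOpen (connectedComponentIn (centredBasin l) z) :=
    (isOpen_centredBasin hl0 hl2).connectedComponentIn
  obtain ⟨w, hw1, hw2⟩ := mem_closure_iff.1 hz _ ho (mem_connectedComponentIn hb)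
  rw [centredImmediateBasin_def] at *
  rw [connectedComponentIn_eq hw2, ← connectedComponentIn_eq hw1]
  exact mem_connectedComponentIn hb

/-! ### Orbits on the boundary lines of the strip -/

lemma sin_eq_zero_of_abs_eq_pi {y : ℝ} (h : |y| = Real.pi) : Real.sin y = 0 ∧ Real.cos y = -1 := by
  rcases (abs_eq Real.pi_pos.le).1 h with h | h <;> simp [h]

lemma centredMap_of_abs_im_eq_pi {l : ℝ} {z : ℂ} (h : |z.im| = Real.pi) :
    (centredMap l z).re = z.re + l + l * Real.exp z.re ∧ |(centredMap l z).im| = Real.pi := by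
  obtain ⟨h1, h2⟩ := sin_eq_zero_of_abs_eq_pi h
  rw [centredMap_re, centredMap_im, h1, h2]
  simp [h]

lemma iterate_abs_im_eq_pi {l : ℝ} {z : ℂ} (h : |z.im| = Real.pi) (n : ℕ) :
    |((centredMap l)^[n] z).im| = Real.pi := by
  induction n with
  | zero => simpa
  | succ n ih => rw [Function.iterate_succ_apply']; exact (centredMap_of_abs_im_eq_pi ih).2

lemma iterate_succ_re_of_abs_im_eq_pi {l : ℝ} {z : ℂ} (h : |z.im| = Real.pi) (n : ℕ) :
    ((centredMap l)^[n + 1] z).re =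
      ((centredMap l)^[n] z).re + l + l * Real.exp ((centredMap l)^[n] z).re := by
  rw [Function.iterate_succ_apply']
  exact (centredMap_of_abs_im_eq_pi (iterate_abs_im_eq_pi h n)).1

lemma tendsto_re_of_abs_im_eq_pi {l : ℝ} (hl0 : 0 < l) {z : ℂ} (h : |z.im| = Real.pi) :
    Tendsto (fun n : ℕ => ((centredMap l)^[n] z).re) atTop atTop := by
  have hb : ∀ n : ℕ, z.re + n * l ≤ ((centredMap l)^[n] z).re := by
    intro n
    induction n with
    | zero => simp
    | succ n ih =>
      rw [iterate_succ_re_of_abs_im_eq_pi h]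
      push_cast
      nlinarith [Real.exp_pos ((centredMap l)^[n] z).re]
  refine tendsto_atTop_mono hb ?_
  exact tendsto_atTop_add_const_left _ _ (tendsto_natCast_atTop_atTop.atTop_mul_const hl0)

lemma notMem_centredBasin_of_abs_im_eq_pi {l : ℝ} (hl0 : 0 < l) {z : ℂ} (h : |z.im| = Real.pi) :
    z ∉ centredBasin l := by
  intro hz
  have h1 : Tendsto (fun n : ℕ => ((centredMap l)^[n] z).re) atTop (𝓝 (0 : ℂ).re) :=
    (Complex.continuous_re.tendsto 0).comp hz
  exact not_tendsto_nhds_of_tendsto_atTop (tendsto_re_of_abs_im_eq_pi hl0 h) _ h1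

/-- The orbits on the lines `Im z = ±π` escape, hence these lines bound the immediate basin. -/
lemma centredImmediateBasin_subset_strip {l : ℝ} (hl0 : 0 < l) :
    centredImmediateBasin l ⊆ strip := by
  intro z hz
  by_contra hs
  have hc : IsPreconnected ((fun z : ℂ => |z.im|) '' centredImmediateBasin l) :=
    (isPreconnected_centredImmediateBasin l).image _ (Complex.continuous_im.abs).continuousOn
  have := hc.Icc_subset ⟨0, zero_mem_centredImmediateBasin l, rfl⟩ ⟨z, hz, rfl⟩
  obtain ⟨w, hw, hw'⟩ := this ⟨by simpa using Real.pi_pos.le, not_lt.1 hs⟩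
  exact notMem_centredBasin_of_abs_im_eq_pi hl0 hw' (centredImmediateBasin_subset l hw)

/-- Eventually the real part at least doubles at each step on the lines `Im z = ±π`. -/
lemma exists_pow_le_re_of_abs_im_eq_pi {l : ℝ} (hl0 : 0 < l) {z : ℂ} (h : |z.im| = Real.pi) :
    ∃ N : ℕ, ∀ n : ℕ, (2 : ℝ) ^ n ≤ ((centredMap l)^[n + N] z).re := by
  have h1 : ∀ᶠ x : ℝ in atTop, x ≤ l * Real.exp x := by
    have := (Real.tendsto_exp_div_pow_atTop 1).eventually_ge_atTop l⁻¹
    filter_upwards [this, eventually_gt_atTop 0] with x hx hx0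
    rw [pow_one, le_div_iff₀ hx0, inv_mul_le_iff₀ hl0] at hx
    exact hx
  have h2 := (tendsto_re_of_abs_im_eq_pi hl0 h).eventually (h1.and (eventually_ge_atTop 1))
  obtain ⟨N, hN⟩ := eventually_atTop.1 h2
  refine ⟨N, fun n => ?_⟩
  induction n with
  | zero => simpa using (hN N le_rfl).2
  | succ n ih =>
    rw [show n + 1 + N = (n + N) + 1 by ring, iterate_succ_re_of_abs_im_eq_pi h, pow_succ]
    linarith [(hN (n + N) (by omega)).1]

/-! ### The immediate basin contains the left half of the real axis -/

lemma one_sub_mul_exp_lt {u : ℝ} (hu : 0 < u) : (1 - u) * Real.exp u < (1 + u) * Real.exp (-u) := by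
  have hd : ∀ x : ℝ, HasDerivAt (fun u : ℝ => (1 + u) * Real.exp (-u) - (1 - u) * Real.exp u)
      (x * (Real.exp x - Real.exp (-x))) x := by
    intro x
    have h1 := ((hasDerivAt_id x).const_add 1).mul ((hasDerivAt_neg x).exp)
    have h2 := ((hasDerivAt_id x).const_sub 1).mul (Real.hasDerivAt_exp x)
    refine (h1.sub h2).congr_deriv ?_
    simp; ring
  have hm : StrictMonoOn (fun u : ℝ => (1 + u) * Real.exp (-u) - (1 - u) * Real.exp u) (Ici 0) := by
    refine strictMonoOn_of_deriv_pos (convex_Ici 0)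
      (fun x _ => (hd x).continuousAt.continuousWithinAt) fun x hx => ?_
    rw [interior_Ici, mem_Ioi] at hx
    rw [(hd x).deriv]
    exact mul_pos hx (sub_pos.2 (Real.exp_lt_exp.2 (by linarith)))
  have := hm self_mem_Ici hu.le hu
  simp at this
  linarith

/-- With `u = 1 - e^x`, the centred map on the real axis becomes `u ↦ 1 - (1 - u)e^{λu}`; the
absolute value of `u` is a strict Lyapunov function. -/
lemma abs_one_sub_mul_exp_sub_one_lt {l u : ℝ} (hl0 : 0 < l) (hl2 : l < 2) (hu : u ≠ 0)
    (hu1 : |u| < 1) : |1 - (1 - u) * Real.exp (l * u)| < |u| := by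
  rw [abs_lt] at hu1
  rcases lt_or_gt_of_ne hu with hneg | hpos
  · rw [abs_of_neg hneg, abs_lt]
    have key := one_sub_mul_exp_lt (neg_pos.2 hneg)
    rw [neg_neg] at key
    have e1 : Real.exp (2 * u) < Real.exp (l * u) := Real.exp_lt_exp.2 (by nlinarith)
    have e2 : Real.exp (l * u) < 1 := Real.exp_lt_one_iff.2 (by nlinarith)
    have e3 : Real.exp (2 * u) = Real.exp u * Real.exp u := by rw [← Real.exp_add]; ring_nf
    have e4 : Real.exp u * Real.exp (-u) = 1 := by rw [← Real.exp_add]; simp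
    have e5 := mul_lt_mul_of_pos_left key (Real.exp_pos u)
    constructor <;> nlinarith
  · rw [abs_of_pos hpos, abs_lt]
    have key := one_sub_mul_exp_lt hpos
    have e1 : Real.exp (l * u) < Real.exp (2 * u) := Real.exp_lt_exp.2 (by nlinarith)
    have e2 : 1 < Real.exp (l * u) := Real.one_lt_exp_iff.2 (by positivity)
    have e3 : Real.exp (2 * u) = Real.exp u * Real.exp u := by rw [← Real.exp_add]; ring_nf
    have e4 : Real.exp u * Real.exp (-u) = 1 := by rw [← Real.exp_add]; simp
    have e5 := mul_lt_mul_of_pos_left key (Real.exp_pos u)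
    constructor <;> nlinarith

/-- A continuous self-map of the real line that strictly decreases `|u|` on `0 < |u| < 1` attracts
`(-1, 1)` to `0`. -/
lemma tendsto_iterate_of_abs_lt {φ : ℝ → ℝ} (hc : Continuous φ)
    (hφ : ∀ u, u ≠ 0 → |u| < 1 → |φ u| < |u|) {u : ℝ} (hu : |u| < 1) :
    Tendsto (fun n : ℕ => φ^[n] u) atTop (𝓝 0) := by
  have h0 : φ 0 = 0 := by
    have h1 : ∀ᶠ x : ℝ in 𝓝[≠] 0, |φ x| ≤ |x| := by
      have : ∀ᶠ x : ℝ in 𝓝[≠] 0, |x| < 1 := by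
        refine nhdsWithin_le_nhds ?_
        exact (continuous_abs.tendsto (0 : ℝ)).eventually (gt_mem_nhds (by simp))
      filter_upwards [this, self_mem_nhdsWithin] with x hx hx0
      exact (hφ x hx0 hx).le
    have h2 := le_of_tendsto_of_tendsto ((hc.abs.tendsto 0).mono_left nhdsWithin_le_nhds)
      ((continuous_abs.tendsto (0 : ℝ)).mono_left nhdsWithin_le_nhds) h1
    simpa using h2
  have hle : ∀ v, |v| < 1 → |φ v| ≤ |v| := by
    intro v hv
    rcases eq_or_ne v 0 with rfl | hv0
    · simp [h0]
    · exact (hφ v hv0 hv).le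
  have hbd : ∀ n, |φ^[n] u| ≤ |u| := by
    intro n
    induction n with
    | zero => simp
    | succ n ih =>
      rw [Function.iterate_succ_apply']
      exact (hle _ (ih.trans_lt hu)).trans ih
  have hanti : Antitone fun n : ℕ => |φ^[n] u| := by
    refine antitone_nat_of_succ_le fun n => ?_
    rw [Function.iterate_succ_apply']
    exact hle _ ((hbd n).trans_lt hu)
  have hlim := tendsto_atTop_ciInf hanti ⟨0, by rintro _ ⟨n, rfl⟩; exact abs_nonneg _⟩
  set L := ⨅ n : ℕ, |φ^[n] u|
  obtain ⟨w, hw, ψ, hψ, hwl⟩ := isCompact_Icc.tendsto_subseq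
    (fun n : ℕ => (abs_le.1 (hbd n) : φ^[n] u ∈ Icc (-|u|) |u|))
  have hw1 : |w| < 1 := (abs_le.2 hw).trans_lt hu
  have hL1 : |w| = L :=
    tendsto_nhds_unique ((continuous_abs.tendsto w).comp hwl) (hlim.comp hψ.tendsto_atTop)
  have hL2 : |φ w| = L := by
    have h1 := (hc.abs.tendsto w).comp hwl
    have h2 : Tendsto (fun n : ℕ => |φ^[n + 1] u|) atTop (𝓝 L) :=
      hlim.comp (tendsto_add_atTop_nat 1)
    refine tendsto_nhds_unique h1 ((h2.comp hψ.tendsto_atTop).congr fun n => ?_)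
    simp only [Function.comp, Function.iterate_succ_apply']
  have hw0 : w = 0 := by
    by_contra hne
    exact absurd (hL2.trans hL1.symm) (hφ w hne hw1).ne
  rw [hw0, abs_zero] at hL1
  rw [← hL1] at hlim
  exact (tendsto_zero_iff_abs_tendsto_zero _).2 hlim

lemma ofReal_mem_centredBasin {l : ℝ} (hl0 : 0 < l) (hl2 : l < 2) {x : ℝ} (hx : x ≤ 0) :
    (x : ℂ) ∈ centredBasin l := by
  set φ : ℝ → ℝ := fun u => 1 - (1 - u) * Real.exp (l * u)
  set γ : ℝ → ℝ := fun x => x + l - l * Real.exp x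
  have hsemi : ∀ x, 1 - Real.exp (γ x) = φ (1 - Real.exp x) := by
    intro x
    simp only [φ, γ]
    rw [show x + l - l * Real.exp x = x + l * (1 - Real.exp x) by ring, Real.exp_add]
    ring
  have hsemi' : ∀ n : ℕ, 1 - Real.exp (γ^[n] x) = φ^[n] (1 - Real.exp x) := by
    intro n
    induction n with
    | zero => rfl
    | succ n ih => rw [Function.iterate_succ_apply', hsemi, ih, Function.iterate_succ_apply']
  have hit : ∀ n : ℕ, (centredMap l)^[n] (x : ℂ) = ((γ^[n] x : ℝ) : ℂ) := by
    intro n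
    induction n with
    | zero => rfl
    | succ n ih => rw [Function.iterate_succ_apply', ih, centredMap_ofReal,
        Function.iterate_succ_apply']
  have hconv : Tendsto (fun n : ℕ => φ^[n] (1 - Real.exp x)) atTop (𝓝 0) := by
    refine tendsto_iterate_of_abs_lt (by fun_prop)
      (fun u hu hu1 => abs_one_sub_mul_exp_sub_one_lt hl0 hl2 hu hu1) ?_
    have := Real.exp_pos x
    have := Real.exp_le_one_iff.2 hx
    rw [abs_lt]; constructor <;> linarith
  have h1 : Tendsto (fun n : ℕ => Real.exp (γ^[n] x)) atTop (𝓝 1) := by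
    have := hconv.const_sub 1
    rw [sub_zero] at this
    refine this.congr fun n => ?_
    rw [← hsemi' n]; ring
  have h2 : Tendsto (fun n : ℕ => γ^[n] x) atTop (𝓝 0) := by
    have := (Real.continuousAt_log one_ne_zero).tendsto.comp h1
    simpa [Function.comp_def] using this
  change Tendsto _ _ _
  simp only [hit]
  simpa [Function.comp_def] using (Complex.continuous_ofReal.tendsto 0).comp h2

lemma ofReal_mem_centredImmediateBasin {l : ℝ} (hl0 : 0 < l) (hl2 : l < 2) {x : ℝ} (hx : x ≤ 0) :
    (x : ℂ) ∈ centredImmediateBasin l := by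
  have := subset_centredImmediateBasin (l := l) (S := Complex.ofReal '' Iic 0)
    (isPreconnected_Iic.image _ Complex.continuous_ofReal.continuousOn) ⟨0, by simp, by simp⟩
    (by rintro _ ⟨y, hy, rfl⟩; exact ofReal_mem_centredBasin hl0 hl2 hy)
  exact this ⟨x, hx, rfl⟩

/-! ### A Harnack inequality and locally uniform limits on the sphere -/

/-- A zero-free holomorphic function on a disc has a holomorphic logarithm whose value at the
centre is the principal one. -/
lemma exists_log_on_ball {u : ℂ → ℂ} {c : ℂ} {R : ℝ} (hR : 0 < R)
    (hu : DifferentiableOn ℂ u (Metric.ball c R)) (h0 : ∀ z ∈ Metric.ball c R, u z ≠ 0) :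
    ∃ w : ℂ → ℂ, DifferentiableOn ℂ w (Metric.ball c R) ∧ w c = Complex.log (u c) ∧
      ∀ z ∈ Metric.ball c R, Complex.exp (w z) = u z := by
  have hd : DifferentiableOn ℂ (fun z => deriv u z / u z) (Metric.ball c R) :=
    (hu.deriv Metric.isOpen_ball).div hu h0
  obtain ⟨w, hwc, hw⟩ := hd.isExactOn_ball.with_val_at c (Complex.log (u c))
  refine ⟨w, fun z hz => (hw z hz).differentiableAt.differentiableWithinAt, hwc, ?_⟩
  have hcm : c ∈ Metric.ball c R := Metric.mem_ball_self hR
  have hder : ∀ z ∈ Metric.ball c R,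
      HasDerivAt (fun z => u z * Complex.exp (-(w z))) 0 z := by
    intro z hz
    have h1 := (hu.differentiableAt (Metric.isOpen_ball.mem_nhds hz)).hasDerivAt
    refine (h1.mul (hw z hz).neg.cexp).congr_deriv ?_
    have := h0 z hz
    field_simp
    ring
  intro z hz
  have hconst := (convex_ball c R).is_const_of_fderivWithin_eq_zero (𝕜 := ℂ)
    (f := fun z => u z * Complex.exp (-(w z)))
    (fun z hz => (hder z hz).differentiableAt.differentiableWithinAt)
    (fun z hz => by
      rw [fderivWithin_of_isOpen Metric.isOpen_ball hz]
      ext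
      simp [(hder z hz).deriv]) hz hcm
  simp only [hwc, Complex.exp_neg, Complex.exp_log (h0 c hcm)] at hconst
  rw [mul_inv_cancel₀ (h0 c hcm)] at hconst
  rw [← div_eq_mul_inv, div_eq_one_iff_eq (Complex.exp_ne_zero _)] at hconst
  exact hconst.symm

/-- Harnack's inequality for the positive harmonic function `log ‖u‖`, with a non-sharp constant:
the Borel–Carathéodory theorem applied to `-log u`. -/
lemma log_norm_le_of_one_le_norm {u : ℂ → ℂ} {c z : ℂ} {R : ℝ}
    (hu : DifferentiableOn ℂ u (Metric.ball c R)) (h1 : ∀ z ∈ Metric.ball c R, 1 ≤ ‖u z‖)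
    (hz : z ∈ Metric.ball c (R / 2)) :
    Real.log ‖u z‖ ≤ 3 * (Real.log ‖u c‖ + Real.pi) := by
  have hR : 0 < R := by
    have := Metric.pos_of_mem_ball hz
    linarith
  have h0 : ∀ z ∈ Metric.ball c R, u z ≠ 0 := fun z hz h => by
    have := h1 z hz
    rw [h, norm_zero] at this
    linarith
  obtain ⟨w, hw, hwc, hexp⟩ := exists_log_on_ball hR hu h0
  have hre : ∀ z ∈ Metric.ball c R, (w z).re = Real.log ‖u z‖ := by
    intro z hz
    rw [← hexp z hz, Complex.norm_exp, Real.log_exp]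
  have hcm : c ∈ Metric.ball c R := Metric.mem_ball_self hR
  have hmaps : MapsTo (fun ζ : ℂ => c + ζ) (Metric.ball 0 R) (Metric.ball c R) := by
    intro ζ hζ
    simpa using hζ
  have hz' : ‖z - c‖ < R / 2 := by simpa [dist_eq_norm] using hz
  have hzR : z - c ∈ Metric.ball (0 : ℂ) R := by
    rw [mem_ball_zero_iff]; linarith
  -- the bound of the theorem holds for every `M > 0`, hence for `M = 0`
  have key : ∀ M : ℝ, 0 < M → ‖w z‖ ≤ 2 * M + 3 * ‖w c‖ := by
    intro M hM
    have := Complex.borelCaratheodory (f := fun ζ => -w (c + ζ)) (M := M) (R := R) (z := z - c) hM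
      ((hw.comp (by fun_prop) hmaps).neg)
      (fun ζ hζ => by
        have h2 := hre _ (hmaps hζ)
        have h3 := Real.log_nonneg (h1 _ (hmaps hζ))
        change (-w (c + ζ)).re ≤ M
        rw [Complex.neg_re]; linarith) hR hzR
    simp only [add_sub_cancel, norm_neg, add_zero] at this
    have hden : 0 < R - ‖z - c‖ := by linarith
    have e1 : 2 * M * ‖z - c‖ / (R - ‖z - c‖) ≤ 2 * M := by
      rw [div_le_iff₀ hden]; nlinarith [norm_nonneg (z - c)]
    have e2 : ‖w c‖ * (R + ‖z - c‖) / (R - ‖z - c‖) ≤ 3 * ‖w c‖ := by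
      rw [div_le_iff₀ hden]; nlinarith [norm_nonneg (w c)]
    linarith
  have key' : ‖w z‖ ≤ 3 * ‖w c‖ := by
    refine le_of_forall_pos_le_add fun ε hε => ?_
    linarith [key (ε / 2) (by positivity)]
  have hwc' : ‖w c‖ ≤ Real.log ‖u c‖ + Real.pi := by
    refine (Complex.norm_le_abs_re_add_abs_im _).trans ?_
    rw [hre c hcm, abs_of_nonneg (Real.log_nonneg (h1 c hcm)), hwc, Complex.log_im]
    gcongr
    exact Complex.abs_arg_le_pi _
  have hzb : z ∈ Metric.ball c R := Metric.ball_subset_ball (by linarith) hz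
  calc Real.log ‖u z‖ = (w z).re := (hre z hzb).symm
    _ ≤ ‖w z‖ := Complex.re_le_norm _
    _ ≤ 3 * ‖w c‖ := key'
    _ ≤ _ := by gcongr

/-- The neighbourhood `{∞} ∪ {|z| ≥ R}` of `∞` in the Riemann sphere. -/
lemma compl_ball_mem_nhds_infty (R : ℝ) :
    ((↑) '' Metric.ball (0 : ℂ) R : Set (OnePoint ℂ))ᶜ ∈ 𝓝 (OnePoint.infty : OnePoint ℂ) := by
  have : IsOpen ((↑) '' Metric.closedBall (0 : ℂ) R : Set (OnePoint ℂ))ᶜ :=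
    OnePoint.isOpen_compl_image_coe.2
      ⟨Metric.isClosed_closedBall, isCompact_closedBall 0 R⟩
  refine mem_of_superset (this.mem_nhds (by simp)) ?_
  exact compl_subset_compl.2 (image_mono Metric.ball_subset_closedBall)

lemma exists_closedBall_compl_subset {N : Set (OnePoint ℂ)}
    (hN : N ∈ 𝓝 (OnePoint.infty : OnePoint ℂ)) :
    ∃ R : ℝ, ∀ z : ℂ, R < ‖z‖ → (z : OnePoint ℂ) ∈ N := by
  have h1 : Tendsto ((↑) : ℂ → OnePoint ℂ) (coclosedCompact ℂ) (𝓝 OnePoint.infty) :=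
    OnePoint.tendsto_coe_infty
  have h2 := h1.eventually hN
  rw [coclosedCompact_eq_cocompact, ← Metric.cobounded_eq_cocompact,
    ← comap_norm_atTop, eventually_comap] at h2
  obtain ⟨R, hR⟩ := eventually_atTop.1 h2
  exact ⟨R, fun z hz => hR _ hz.le z rfl⟩

/-- A sequence of finite points converges to `∞` in the sphere if and only if the moduli tend to
infinity. -/
lemma tendsto_infty_iff_norm {ι : Type*} {p : Filter ι} {u : ι → ℂ} :
    Tendsto (fun j => (u j : OnePoint ℂ)) p (𝓝 OnePoint.infty) ↔
      Tendsto (fun j => ‖u j‖) p atTop := by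
  constructor
  · intro h
    refine tendsto_atTop.2 fun R => ?_
    filter_upwards [h.eventually (compl_ball_mem_nhds_infty R)] with j hj
    by_contra hlt
    exact hj ⟨u j, by simpa using hlt, rfl⟩
  · intro h N hN
    obtain ⟨R, hR⟩ := exists_closedBall_compl_subset hN
    rw [mem_map]
    filter_upwards [h.eventually_gt_atTop R] with j hj
    exact hR _ hj

/-- Near a point where a locally uniform limit takes the value `∞`, the approximating maps
are eventually at least `1` in modulus. -/
lemma exists_ball_one_le_norm {F : ℕ → ℂ → ℂ} {g : ℂ → OnePoint ℂ} {V : Set ℂ} (hV : IsOpen V)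
    (hg : ContinuousOn g V)
    (h : TendstoLocallyUniformlyOn (fun j z => (F j z : OnePoint ℂ)) g atTop V) {b : ℂ}
    (hb : b ∈ V) (hgb : g b = OnePoint.infty) :
    ∃ r > 0, Metric.ball b r ⊆ V ∧ ∀ᶠ j in atTop, ∀ z ∈ Metric.ball b r, 1 ≤ ‖F j z‖ := by
  obtain ⟨u, hu, hsub⟩ := UniformSpace.mem_nhds_iff.1 (compl_ball_mem_nhds_infty 1)
  obtain ⟨v, hv, hvu⟩ := comp_mem_uniformity_sets hu
  obtain ⟨t, ht, hev⟩ := h v hv b hb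
  rw [hV.nhdsWithin_eq hb] at ht
  have hgt : ∀ᶠ z in 𝓝 b, g z ∈ UniformSpace.ball OnePoint.infty v := by
    have hca := (hg.continuousAt (hV.mem_nhds hb)).tendsto
    rw [hgb] at hca
    exact hca.eventually (UniformSpace.ball_mem_nhds _ hv)
  obtain ⟨r, hr, hball⟩ := Metric.mem_nhds_iff.1 (inter_mem (inter_mem ht hgt) (hV.mem_nhds hb))
  refine ⟨r, hr, fun z hz => (hball hz).2, ?_⟩
  filter_upwards [hev] with j hj z hz
  have h1 : (g z, (F j z : OnePoint ℂ)) ∈ v := hj z (hball hz).1.1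
  have h2 : (OnePoint.infty, g z) ∈ v := (hball hz).1.2
  have h3 : (F j z : OnePoint ℂ) ∈ UniformSpace.ball OnePoint.infty u :=
    hvu ⟨g z, h2, h1⟩
  by_contra hlt
  exact hsub h3 ⟨F j z, by simpa using hlt, rfl⟩

/-- The spherical limit of holomorphic functions on a connected open set is identically `∞` as
soon as it takes this value once. -/
lemma eq_infty_of_tendstoLocallyUniformlyOn {F : ℕ → ℂ → ℂ} {g : ℂ → OnePoint ℂ} {V : Set ℂ}
    (hV : IsOpen V) (hVc : IsPreconnected V) (hF : ∀ j, Differentiable ℂ (F j))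
    (h : TendstoLocallyUniformlyOn (fun j z => (F j z : OnePoint ℂ)) g atTop V) {a : ℂ}
    (ha : a ∈ V) (hga : g a = OnePoint.infty) : ∀ z ∈ V, g z = OnePoint.infty := by
  have hg : ContinuousOn g V := h.continuousOn (Frequently.of_forall fun j =>
    (OnePoint.continuous_coe.comp (hF j).continuous).continuousOn)
  have hopen1 : IsOpen (V ∩ g ⁻¹' {OnePoint.infty}) := by
    rw [isOpen_iff_mem_nhds]
    rintro b ⟨hb, hgb⟩
    obtain ⟨r, hr, hrV, hev⟩ := exists_ball_one_le_norm hV hg h hb hgb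
    refine mem_of_superset (Metric.ball_mem_nhds b (by positivity : 0 < r / 4)) fun z hz => ?_
    have hzV : z ∈ V := hrV (Metric.ball_subset_ball (by linarith) hz)
    refine ⟨hzV, ?_⟩
    have hFb : Tendsto (fun j => ‖F j b‖) atTop atTop := by
      have := h.tendsto_at hb
      rw [hgb] at this
      exact tendsto_infty_iff_norm.1 this
    have hlog : Tendsto (fun j => Real.log ‖F j b‖) atTop atTop := Real.tendsto_log_atTop.comp hFb
    have hle : ∀ᶠ j in atTop, Real.log ‖F j b‖ / 3 - Real.pi ≤ Real.log ‖F j z‖ := by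
      filter_upwards [hev] with j hj
      have hsub : Metric.ball z (r / 2) ⊆ Metric.ball b r := by
        refine Metric.ball_subset_ball' ?_
        rw [Metric.mem_ball] at hz
        linarith
      have := log_norm_le_of_one_le_norm (c := z) (z := b) (R := r / 2)
        (hF j).differentiableOn (fun w hw => hj w (hsub hw))
        (by rw [Metric.mem_ball, dist_comm, ← Metric.mem_ball]
            exact Metric.ball_subset_ball (by linarith) hz)
      linarith
    have hlogz : Tendsto (fun j => Real.log ‖F j z‖) atTop atTop := by
      refine tendsto_atTop_mono' _ hle ?_
      exact tendsto_atTop_add_const_right _ _ (hlog.atTop_div_const (by norm_num))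
    have hFz : Tendsto (fun j => ‖F j z‖) atTop atTop := by
      refine tendsto_atTop_mono' _ ?_ hlogz
      exact Eventually.of_forall fun j => Real.log_le_self (norm_nonneg _)
    exact tendsto_nhds_unique (h.tendsto_at hzV) (tendsto_infty_iff_norm.2 hFz)
  have hopen2 : IsOpen (V ∩ g ⁻¹' {OnePoint.infty}ᶜ) :=
    hg.isOpen_inter_preimage hV isOpen_compl_singleton
  intro z hz
  by_contra hne
  obtain ⟨w, -, hw1, hw2⟩ := hVc _ _ hopen1 hopen2
    (fun w hw => by
      by_cases hgw : g w = OnePoint.infty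
      · exact Or.inl ⟨hw, hgw⟩
      · exact Or.inr ⟨hw, hgw⟩) ⟨a, ha, ha, hga⟩ ⟨z, hz, hz, hne⟩
  exact hw2.2 hw1.2

/-- If the limit is identically `∞`, the maps are eventually at least `1` in modulus on every
compact set. -/
lemma eventually_one_le_norm_of_isCompact {F : ℕ → ℂ → ℂ} {g : ℂ → OnePoint ℂ} {V K : Set ℂ}
    (hV : IsOpen V)
    (h : TendstoLocallyUniformlyOn (fun j z => (F j z : OnePoint ℂ)) g atTop V)
    (hg : ∀ z ∈ V, g z = OnePoint.infty) (hK : IsCompact K) (hKV : K ⊆ V) :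
    ∀ᶠ j in atTop, ∀ z ∈ K, 1 ≤ ‖F j z‖ := by
  obtain ⟨u, hu, hsub⟩ := UniformSpace.mem_nhds_iff.1 (compl_ball_mem_nhds_infty 1)
  filter_upwards [(tendstoLocallyUniformlyOn_iff_forall_isCompact hV).1 h K hKV hK u hu]
    with j hj z hz
  have h1 := hj z hz
  rw [hg z (hKV hz)] at h1
  by_contra hlt
  exact hsub h1 ⟨F j z, by simpa using hlt, rfl⟩

/-- A sequence of maps that tends to `∞` uniformly on a set forms a normal family there. -/
lemma normalOn_of_uniform_growth {F : ℕ → ℂ → ℂ} {U : Set ℂ}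
    (h : ∀ R : ℝ, ∀ᶠ n in atTop, ∀ z ∈ U, R < ‖F n z‖) :
    NormalOn (fun n z => (F n z : OnePoint ℂ)) U := by
  intro φ
  by_cases hb : ∃ m, ∃ᶠ j in atTop, φ j = m
  · -- a value taken infinitely often gives a constant subsequence
    obtain ⟨m, hm⟩ := hb
    obtain ⟨ψ, hψ, hψm⟩ := extraction_of_frequently_atTop hm
    refine ⟨ψ, hψ, fun z => (F m z : OnePoint ℂ), ?_⟩
    simp only [hψm]
    refine TendstoUniformlyOn.tendstoLocallyUniformlyOn fun u hu => ?_
    exact Eventually.of_forall fun j z _ => refl_mem_uniformity hu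
  · -- otherwise the indices tend to infinity and the limit is the constant `∞`
    push Not at hb
    have hφ : Tendsto φ atTop atTop := by
      refine tendsto_atTop.2 fun N => ?_
      have : ∀ᶠ j in atTop, ∀ m ∈ Finset.range N, φ j ≠ m := by
        rw [Filter.eventually_all_finset]
        exact fun m _ => hb m
      filter_upwards [this] with j hj
      by_contra hlt
      exact hj (φ j) (Finset.mem_range.2 (not_le.1 hlt)) rfl
    refine ⟨id, strictMono_id, fun _ => OnePoint.infty, ?_⟩
    refine TendstoUniformlyOn.tendstoLocallyUniformlyOn fun u hu => ?_
    obtain ⟨R, hR⟩ := exists_closedBall_compl_subset (UniformSpace.ball_mem_nhds OnePoint.infty hu)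
    filter_upwards [hφ.eventually (h R)] with j hj z hz
    exact hR _ (hj z hz)

/-! ### The translated basins are Fatou components -/

lemma tendsto_norm_fixedPt_add (k : ℤ) (r : ℝ) :
    Tendsto (fun n : ℕ => ‖fixedPt (k + n)‖ - r) atTop atTop := by
  have h1 : ∀ n : ℕ, 2 * Real.pi * n - ‖fixedPt k‖ - r ≤ ‖fixedPt (k + n)‖ - r := by
    intro n
    have h2 := norm_sub_norm_le ((n : ℂ) * (2 * Real.pi * Complex.I)) (-fixedPt k)
    rw [sub_neg_eq_add, norm_neg, add_comm _ (fixedPt k), ← fixedPt_add] at h2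
    have h3 : ‖(n : ℂ) * (2 * Real.pi * Complex.I)‖ = 2 * Real.pi * n := by
      simp [abs_of_pos Real.pi_pos]; ring
    linarith
  refine tendsto_atTop_mono h1 ?_
  refine tendsto_atTop_add_const_right _ _ (tendsto_atTop_add_const_right _ _ ?_)
  exact tendsto_natCast_atTop_atTop.const_mul_atTop (by positivity)

lemma norm_iterate_FMap_ge (l : ℝ) (k : ℤ) (n : ℕ) (z : ℂ) :
    ‖fixedPt (k + n)‖ - ‖(centredMap l)^[n] z‖ ≤ ‖(FMap l)^[n] (fixedPt k + z)‖ := by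
  rw [iterate_FMap_fixedPt_add]
  have := norm_sub_norm_le (fixedPt (k + n)) (-(centredMap l)^[n] z)
  rwa [norm_neg, sub_neg_eq_add] at this

/-- On the basin the iterates of `f_λ` stay bounded, hence those of `F_λ` tend to `∞`. -/
lemma fixedPt_add_mem_fatouSet {l : ℝ} (hl0 : 0 < l) (hl2 : l < 2) (k : ℤ) {z : ℂ}
    (hz : z ∈ centredBasin l) : fixedPt k + z ∈ fatouSet (FMap l) := by
  obtain ⟨q, r, hq0, hq1, hr, -, hcon⟩ := exists_contracting_ball hl0 hl2
  have hm := mapsTo_ball_of_contracting hq1 hcon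
  obtain ⟨N, hN⟩ := exists_iterate_mem_ball hr hz
  refine ⟨(fun w => (centredMap l)^[N] (w - fixedPt k)) ⁻¹' Metric.ball 0 r,
    Metric.isOpen_ball.preimage ((continuous_iterate_centredMap l N).comp (by fun_prop)),
    by simpa using hN, ?_⟩
  refine normalOn_of_uniform_growth fun R => ?_
  have h1 := (tendsto_add_atTop_iff_nat 1).2 (tendsto_norm_fixedPt_add k r)
  filter_upwards [h1.eventually_gt_atTop R, eventually_ge_atTop N] with n hn hnN w hw
  have h2 := norm_iterate_FMap_ge l k (n + 1) (w - fixedPt k)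
  rw [add_sub_cancel] at h2
  have h3 : (centredMap l)^[n + 1] (w - fixedPt k) ∈ Metric.ball 0 r := by
    have := hm.iterate (n + 1 - N) hw
    rwa [← Function.iterate_add_apply, Nat.sub_add_cancel (by omega)] at this
  rw [mem_ball_zero_iff] at h3
  linarith

lemma iterate_mem_strip_of_mem {l : ℝ} (hl0 : 0 < l) {a : ℂ} (ha : a ∈ centredImmediateBasin l)
    (n : ℕ) : (centredMap l)^[n] a ∈ strip :=
  centredImmediateBasin_subset_strip hl0 ((mapsTo_centredImmediateBasin l).iterate n ha)

/-- The Cayley-type coordinate `(e^{z/2} - 1)/(e^{z/2} + 1)`, which maps the strip `|Im z| < π` onto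
the unit disc. -/
noncomputable def stripToDisc (z : ℂ) : ℂ :=
  (Complex.exp (z / 2) - 1) / (Complex.exp (z / 2) + 1)

lemma exp_half_re_pos {z : ℂ} (hz : z ∈ strip) : 0 < (Complex.exp (z / 2)).re := by
  have hz' : |z.im| < Real.pi := hz
  rw [abs_lt] at hz'
  rw [Complex.exp_re]
  refine mul_pos (Real.exp_pos _) (Real.cos_pos_of_mem_Ioo ⟨?_, ?_⟩) <;> simp <;> linarith

lemma exp_half_add_one_ne_zero {z : ℂ} (hz : z ∈ strip) : Complex.exp (z / 2) + 1 ≠ 0 := by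
  intro h
  have := congrArg Complex.re h
  have := exp_half_re_pos hz
  simp at *
  linarith

lemma differentiableOn_stripToDisc : DifferentiableOn ℂ stripToDisc strip := by
  unfold stripToDisc
  refine DifferentiableOn.div (by fun_prop) (by fun_prop) fun z hz => exp_half_add_one_ne_zero hz

lemma norm_stripToDisc_le {z : ℂ} (hz : z ∈ strip) : ‖stripToDisc z‖ ≤ 1 := by
  have h := exp_half_re_pos hz
  rw [stripToDisc, norm_div]
  refine div_le_one_of_le₀ ?_ (norm_nonneg _)
  rw [← sq_le_sq₀ (norm_nonneg _) (norm_nonneg _), Complex.sq_norm, Complex.sq_norm,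
    Complex.normSq_apply, Complex.normSq_apply]
  simp only [Complex.sub_re, Complex.sub_im, Complex.add_re, Complex.add_im, Complex.one_re,
    Complex.one_im]
  nlinarith

@[simp] lemma stripToDisc_zero : stripToDisc 0 = 0 := by simp [stripToDisc]

/-- The inverse of `stripToDisc` is continuous at `0`. -/
lemma exists_norm_stripToDisc_lt {r : ℝ} (hr : 0 < r) :
    ∃ δ > 0, ∀ z ∈ strip, ‖stripToDisc z‖ < δ → ‖z‖ < r := by
  have hc : ContinuousAt (fun m : ℂ => 2 * Complex.log ((1 + m) / (1 - m))) 0 := by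
    refine continuousAt_const.mul (ContinuousAt.clog ?_ (by simp))
    exact ContinuousAt.div (by fun_prop) (by fun_prop) (by simp)
  obtain ⟨δ, hδ, h⟩ := Metric.continuousAt_iff.1 hc r hr
  refine ⟨δ, hδ, fun z hz hlt => ?_⟩
  have h1 := h (x := stripToDisc z) (by simpa using hlt)
  have hne := exp_half_add_one_ne_zero hz
  have h2 : (1 + stripToDisc z) / (1 - stripToDisc z) = Complex.exp (z / 2) := by
    have e1 : 1 + stripToDisc z = 2 * Complex.exp (z / 2) / (Complex.exp (z / 2) + 1) := by
      rw [stripToDisc]; field_simp; ring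
    have e2 : 1 - stripToDisc z = 2 / (Complex.exp (z / 2) + 1) := by
      rw [stripToDisc]; field_simp; ring
    rw [e1, e2]; field_simp
  have hz' : |z.im| < Real.pi := hz
  rw [abs_lt] at hz'
  have h3 : Complex.log (Complex.exp (z / 2)) = z / 2 := by
    refine Complex.log_exp ?_ ?_ <;> simp <;> linarith [Real.pi_pos]
  simp only [h2, h3] at h1
  simp only [add_zero, sub_zero, div_one, Complex.log_one, mul_zero,
    dist_zero_right] at h1
  rwa [mul_div_cancel₀ z two_ne_zero] at h1

/-- Near a boundary point of the immediate basin, some orbit leaves the strip: if all iterates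
mapped a disc into the strip, the Schwarz lemma would drag the boundary point along with the nearby
points of the basin. -/
lemma exists_abs_im_iterate_eq_pi {l : ℝ} (hl0 : 0 < l) (hl2 : l < 2) {z₀ : ℂ}
    (hz₀ : z₀ ∈ closure (centredImmediateBasin l)) (hz₀' : z₀ ∉ centredImmediateBasin l)
    {ρ : ℝ} (hρ : 0 < ρ) :
    ∃ z ∈ Metric.ball z₀ ρ, ∃ n : ℕ, |((centredMap l)^[n] z).im| = Real.pi := by
  by_contra! hcon
  obtain ⟨a₀, ha₀, ha₀d⟩ := Metric.mem_closure_iff.1 hz₀ ρ hρ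
  have hstrip : ∀ n : ℕ, MapsTo (centredMap l)^[n] (Metric.ball z₀ ρ) strip := by
    intro n z hz
    by_contra hs
    have hc : IsPreconnected ((fun z : ℂ => |((centredMap l)^[n] z).im|) '' Metric.ball z₀ ρ) :=
      (convex_ball z₀ ρ).isPreconnected.image _
        (Complex.continuous_im.comp (continuous_iterate_centredMap l n)).abs.continuousOn
    have := hc.Icc_subset ⟨a₀, by rwa [Metric.mem_ball, dist_comm], rfl⟩ ⟨z, hz, rfl⟩
    obtain ⟨w, hw, hw'⟩ :=
      this ⟨(iterate_mem_strip_of_mem hl0 ha₀ n).le, not_lt.1 hs⟩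
    exact hcon w hw n hw'
  obtain ⟨q, r, hq0, hq1, hr, -, hball⟩ := exists_contracting_ball hl0 hl2
  obtain ⟨δ, hδ, hδr⟩ := exists_norm_stripToDisc_lt hr
  obtain ⟨a, ha, had⟩ := Metric.mem_closure_iff.1 hz₀ (min ρ (δ * ρ / 4)) (by positivity)
  have had1 : dist a z₀ < ρ := by rw [dist_comm]; exact had.trans_le (min_le_left _ _)
  have had2 : dist a z₀ < δ * ρ / 4 := by rw [dist_comm]; exact had.trans_le (min_le_right _ _)
  have hschwarz : ∀ n : ℕ,
      dist (stripToDisc ((centredMap l)^[n] a)) (stripToDisc ((centredMap l)^[n] z₀)) ≤ δ / 2 := by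
    intro n
    have h1 := Complex.dist_le_div_mul_dist_of_mapsTo_ball
      (f := fun z => stripToDisc ((centredMap l)^[n] z)) (c := z₀) (R₁ := ρ) (R₂ := 2) (z := a)
      (differentiableOn_stripToDisc.comp
        (differentiable_iterate_centredMap l n).differentiableOn (hstrip n))
      (fun z hz => by
        rw [Metric.mem_closedBall, dist_eq_norm]
        have e1 := norm_stripToDisc_le (hstrip n hz)
        have e2 := norm_stripToDisc_le (hstrip n (Metric.mem_ball_self hρ))
        exact (norm_sub_le _ _).trans (by linarith))
      had1
    refine h1.trans ?_
    calc 2 / ρ * dist a z₀ ≤ 2 / ρ * (δ * ρ / 4) := by gcongr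
      _ = δ / 2 := by field_simp; norm_num
  have hlim : Tendsto (fun n : ℕ => stripToDisc ((centredMap l)^[n] a)) atTop (𝓝 0) := by
    have hca : ContinuousAt stripToDisc 0 :=
      (differentiableOn_stripToDisc.differentiableAt
        (isOpen_strip.mem_nhds zero_mem_strip)).continuousAt
    have := hca.tendsto.comp (centredImmediateBasin_subset l ha)
    rwa [stripToDisc_zero] at this
  obtain ⟨n, hn⟩ := (hlim.eventually (Metric.ball_mem_nhds 0 (half_pos hδ))).exists
  have hz₀n : ‖stripToDisc ((centredMap l)^[n] z₀)‖ < δ := by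
    rw [dist_zero_right] at hn
    have h1 := hschwarz n
    rw [dist_comm, dist_eq_norm] at h1
    linarith [norm_le_norm_add_norm_sub' (stripToDisc ((centredMap l)^[n] z₀))
      (stripToDisc ((centredMap l)^[n] a))]
  have hmem : (centredMap l)^[n] z₀ ∈ Metric.ball (0 : ℂ) r := by
    rw [mem_ball_zero_iff]
    exact hδr _ (hstrip n (Metric.mem_ball_self hρ)) hz₀n
  exact hz₀' (closure_inter_centredBasin_subset hl0 hl2 hz₀
    (mem_centredBasin_of_iterate_mem n (ball_subset_centredBasin hq0 hq1 hball hmem)))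

/-- The orbits under `F_λ` of points of the basin grow linearly. -/
lemma exists_norm_iterate_FMap_le {l : ℝ} (k : ℤ) {a : ℂ} (ha : a ∈ centredBasin l) :
    ∃ C > 0, ∀ n : ℕ, ‖(FMap l)^[n] (fixedPt k + a)‖ ≤ C * (n + 1) := by
  obtain ⟨M, hM⟩ := Metric.isBounded_range_of_tendsto _ ha |>.exists_norm_le
  have hM0 : 0 ≤ M := (norm_nonneg _).trans (hM _ ⟨0, rfl⟩)
  refine ⟨‖fixedPt k‖ + 2 * Real.pi + M, by positivity, fun n => ?_⟩
  rw [iterate_FMap_fixedPt_add, fixedPt_add]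
  have h3 : ‖(n : ℂ) * (2 * Real.pi * Complex.I)‖ = 2 * Real.pi * n := by
    simp [abs_of_pos Real.pi_pos]; ring
  have h4 := norm_add₃_le (a := fixedPt k) (b := (n : ℂ) * (2 * Real.pi * Complex.I))
    (c := (centredMap l)^[n] a)
  have h5 := hM _ ⟨n, rfl⟩
  have h6 : (0 : ℝ) ≤ n := n.cast_nonneg
  have h7 := norm_nonneg (fixedPt k)
  have h8 := Real.pi_pos
  rw [h3] at h4
  nlinarith [mul_nonneg h7 h6, mul_nonneg h8.le h6, mul_nonneg hM0 h6]

/-- A boundary point of the immediate basin, moved by a fixed point of `f_λ`, is not in the Fatou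
set of `F_λ`: on a disc where the iterates of `F_λ` tend to `∞`, Harnack's inequality does not allow
linear growth of one orbit and exponential growth of another. -/
lemma fixedPt_add_notMem_fatouSet {l : ℝ} (hl0 : 0 < l) (hl2 : l < 2) (k : ℤ) {z₀ : ℂ}
    (hz₀ : z₀ ∈ closure (centredImmediateBasin l)) (hz₀' : z₀ ∉ centredImmediateBasin l) :
    fixedPt k + z₀ ∉ fatouSet (FMap l) := by
  rintro ⟨U, hU, hzU, hnormal⟩
  obtain ⟨ψ, hψ, g, hg⟩ := hnormal id
  obtain ⟨ε, hε, hεU⟩ := Metric.isOpen_iff.1 hU _ hzU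
  set p := fixedPt k
  have hFd : ∀ n : ℕ, Differentiable ℂ (FMap l)^[n] := fun n =>
    Differentiable.iterate (by unfold FMap fMap; fun_prop) n
  have hg' := hg.mono hεU
  simp only [id] at hg'
  set R := ε / 2
  have hR : 0 < R := by positivity
  -- a point of the basin and an orbit that leaves the strip, both close to `z₀`
  obtain ⟨a, ha, had⟩ := Metric.mem_closure_iff.1 hz₀ (R / 4) (by positivity)
  obtain ⟨z, hz, m, hzm⟩ := exists_abs_im_iterate_eq_pi hl0 hl2 hz₀ hz₀' (ρ := R / 4)
    (by positivity)
  have hadist : dist (p + a) (p + z₀) < R / 4 := by rwa [dist_add_left, dist_comm]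
  have hzdist : dist (p + z) (p + a) < R / 2 := by
    rw [dist_add_left]
    have := dist_triangle_right z a z₀
    rw [dist_comm a z₀] at this
    rw [Metric.mem_ball] at hz
    linarith
  obtain ⟨C, hC, hgrow⟩ := exists_norm_iterate_FMap_le k (centredImmediateBasin_subset l ha)
  have haV : p + a ∈ Metric.ball (p + z₀) ε := by
    rw [Metric.mem_ball]; simp only [R] at hadist; linarith
  have hinf : g (p + a) = OnePoint.infty := by
    refine tendsto_nhds_unique (hg'.tendsto_at haV) (tendsto_infty_iff_norm.2 ?_)
    have hb := Metric.isBounded_range_of_tendsto _ (centredImmediateBasin_subset l ha)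
    obtain ⟨M, hM⟩ := hb.exists_norm_le
    have h1 : Tendsto (fun n : ℕ => ‖(FMap l)^[n] (p + a)‖) atTop atTop := by
      refine tendsto_atTop_mono (fun n => ?_) (tendsto_norm_fixedPt_add k M)
      have := norm_iterate_FMap_ge l k n a
      linarith [hM _ ⟨n, rfl⟩]
    exact h1.comp ((tendsto_add_atTop_nat 1).comp hψ.tendsto_atTop)
  have hall := eq_infty_of_tendstoLocallyUniformlyOn Metric.isOpen_ball
    (convex_ball _ _).isPreconnected (fun j => hFd (ψ j + 1)) hg' haV hinf
  have hlarge := eventually_one_le_norm_of_isCompact Metric.isOpen_ball hg' hall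
    (isCompact_closedBall (p + z₀) (5 / 4 * R))
    (Metric.closedBall_subset_ball (by simp only [R]; linarith))
  have hharnack : ∀ᶠ j in atTop, Real.log ‖(FMap l)^[ψ j + 1] (p + z)‖ ≤
      3 * (Real.log ‖(FMap l)^[ψ j + 1] (p + a)‖ + Real.pi) := by
    filter_upwards [hlarge] with j hj
    refine log_norm_le_of_one_le_norm (R := R) (hFd (ψ j + 1)).differentiableOn
      (fun w hw => hj w ?_) hzdist
    rw [Metric.mem_ball] at hw
    rw [Metric.mem_closedBall]
    linarith [dist_triangle w (p + a) (p + z₀)]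
  -- exponential growth of the orbit of `z`
  obtain ⟨N, hN⟩ := exists_pow_le_re_of_abs_im_eq_pi hl0 hzm
  have hexp : ∀ n : ℕ, N + m ≤ n →
      (2 : ℝ) ^ (n - (N + m)) ≤ ‖(FMap l)^[n] (p + z)‖ := by
    intro n hn
    have h1 := hN (n - (N + m))
    rw [← Function.iterate_add_apply, show n - (N + m) + N + m = n by omega] at h1
    have h2 : ((FMap l)^[n] (p + z)).re = ((centredMap l)^[n] z).re := by
      rw [iterate_FMap_fixedPt_add]
      simp [fixedPt]
    exact h1.trans (h2 ▸ Complex.re_le_norm _)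
  have hbound : ∀ᶠ j in atTop, ((ψ j + 1 : ℕ) : ℝ) * Real.log 2 - (N + m) * Real.log 2 ≤
      3 * (Real.log C + Real.log ((ψ j + 1 : ℕ) + 1) + Real.pi) := by
    filter_upwards [hharnack, hlarge,
      (tendsto_add_atTop_nat 1).comp hψ.tendsto_atTop |>.eventually_ge_atTop (N + m)]
    with j hj hj1 hjN
    simp only [Function.comp] at hjN
    have h1 := hexp _ hjN
    have h2 := Real.log_le_log (by positivity) h1
    rw [Real.log_pow, Nat.cast_sub hjN] at h2
    have hpos : 0 < ‖(FMap l)^[ψ j + 1] (p + a)‖ := by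
      have := hj1 (p + a) (by rw [Metric.mem_closedBall]; linarith)
      linarith
    have h3 := Real.log_le_log hpos (hgrow (ψ j + 1))
    rw [Real.log_mul hC.ne' (by positivity)] at h3
    push_cast at *
    linarith
  have hlo : Tendsto (fun x : ℝ => (x * Real.log 2 - (N + m) * Real.log 2) -
      3 * (Real.log C + Real.log (x + 1) + Real.pi)) atTop atTop := by
    have h1 : (fun x : ℝ => Real.log (x + 1)) =o[atTop] fun x : ℝ => x := by
      have h2 : (fun x : ℝ => Real.log (x + 1)) =o[atTop] fun x : ℝ => x + 1 :=
        Real.isLittleO_log_id_atTop.comp_tendsto (tendsto_atTop_add_const_right _ _ tendsto_id)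
      refine h2.trans_isBigO (Asymptotics.IsBigO.of_bound 2 ?_)
      filter_upwards [eventually_ge_atTop 1] with x hx
      rw [Real.norm_of_nonneg (by linarith), Real.norm_of_nonneg (by linarith)]
      linarith
    have hl2' : 0 < Real.log 2 := Real.log_pos (by norm_num)
    have h3 := h1.def (show 0 < Real.log 2 / 6 by positivity)
    refine tendsto_atTop_mono' atTop (f₁ := fun x : ℝ => x * (Real.log 2 / 2) -
      ((N + m) * Real.log 2 + 3 * Real.log C + 3 * Real.pi)) ?_ ?_
    · filter_upwards [h3, eventually_ge_atTop 0] with x hx hx0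
      rw [Real.norm_of_nonneg hx0] at hx
      have := (le_abs_self _).trans hx
      linarith
    · exact tendsto_atTop_add_const_right _ _ (tendsto_id.atTop_mul_const (by positivity))
  have hidx : Tendsto (fun j => ((ψ j + 1 : ℕ) : ℝ)) atTop atTop :=
    tendsto_natCast_atTop_atTop.comp ((tendsto_add_atTop_nat 1).comp hψ.tendsto_atTop)
  obtain ⟨j, hj1, hj2⟩ := (hbound.and ((hlo.comp hidx).eventually_gt_atTop 0)).exists
  simp only [Function.comp] at hj2
  linarith

/-- The immediate basin of `f_λ` at a fixed point is a component of the Fatou set of `F_λ`. -/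
lemma image_eq_connectedComponentIn_fatouSet {l : ℝ} (hl0 : 0 < l) (hl2 : l < 2) (k : ℤ) :
    (fixedPt k + ·) '' centredImmediateBasin l =
      connectedComponentIn (fatouSet (FMap l)) (fixedPt k) := by
  set B := (fixedPt k + ·) '' centredImmediateBasin l with hB
  set V := connectedComponentIn (fatouSet (FMap l)) (fixedPt k)
  have hpB : fixedPt k ∈ B := ⟨0, zero_mem_centredImmediateBasin l, add_zero _⟩
  have hBF : B ⊆ fatouSet (FMap l) := by
    rintro _ ⟨z, hz, rfl⟩
    exact fixedPt_add_mem_fatouSet hl0 hl2 k (centredImmediateBasin_subset l hz)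
  have hBV : B ⊆ V := by
    refine IsPreconnected.subset_connectedComponentIn ?_ hpB hBF
    exact (isPreconnected_centredImmediateBasin l).image _ (by fun_prop)
  have hBo : IsOpen B :=
    (Homeomorph.addLeft (fixedPt k)).isOpenMap _ (isOpen_centredImmediateBasin hl0 hl2)
  refine hBV.antisymm ?_
  have hVc : IsPreconnected V := isPreconnected_connectedComponentIn
  refine hVc.subset_of_closure_inter_subset hBo ⟨fixedPt k, hBV hpB, hpB⟩ ?_
  rintro z ⟨hz, hzV⟩
  have hcl : closure B = (fixedPt k + ·) '' closure (centredImmediateBasin l) :=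
    ((Homeomorph.addLeft (fixedPt k)).image_closure _).symm
  rw [hcl] at hz
  obtain ⟨w, hw, rfl⟩ := hz
  by_contra hne
  refine fixedPt_add_notMem_fatouSet hl0 hl2 k hw (fun h => hne ⟨w, h, rfl⟩)
    (connectedComponentIn_subset _ _ hzV)

/-! ### Wandering, escaping, and no Baker wandering domains -/

lemma isFatouComponent_immediateBasin {l : ℝ} (hl0 : 0 < l) (hl2 : l < 2) (k : ℤ) :
    IsFatouComponent (FMap l) (immediateBasin (fMap l) (fixedPt k)) := by
  rw [immediateBasin_fMap]
  refine ⟨fixedPt k, ?_, image_eq_connectedComponentIn_fatouSet hl0 hl2 k⟩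
  simpa using fixedPt_add_mem_fatouSet hl0 hl2 k (zero_mem_centredBasin l)

lemma IsFatouComponent.eq_of_mem {f : ℂ → ℂ} {U V : Set ℂ} (hU : IsFatouComponent f U)
    (hV : IsFatouComponent f V) {z : ℂ} (hzU : z ∈ U) (hzV : z ∈ V) : U = V := by
  obtain ⟨u, -, rfl⟩ := hU
  obtain ⟨v, -, rfl⟩ := hV
  rw [connectedComponentIn_eq hzU, connectedComponentIn_eq hzV]

lemma fixedPt_mem_immediateBasin (l : ℝ) (k : ℤ) :
    fixedPt k ∈ immediateBasin (fMap l) (fixedPt k) := by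
  rw [immediateBasin_fMap]
  exact ⟨0, zero_mem_centredImmediateBasin l, add_zero _⟩

lemma iterate_FMap_fixedPt (l : ℝ) (k : ℤ) (n : ℕ) :
    (FMap l)^[n] (fixedPt k) = fixedPt (k + n) := by
  simpa [Function.iterate_fixed (centredMap_zero l)] using iterate_FMap_fixedPt_add l k n 0

lemma fixedPt_notMem_immediateBasin {l : ℝ} (hl0 : 0 < l) {k j : ℤ} (h : j ≠ k) :
    fixedPt j ∉ immediateBasin (fMap l) (fixedPt k) := by
  rw [immediateBasin_fMap]
  rintro ⟨z, hz, hzj⟩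
  have h1 : |z.im| < Real.pi := centredImmediateBasin_subset_strip hl0 hz
  have h2 : z = (2 * (j - k) * Real.pi) * Complex.I := by
    have : fixedPt k + z = fixedPt j := hzj
    rw [← eq_sub_iff_add_eq'] at this
    rw [this]; unfold fixedPt; ring
  have h3 : z.im = 2 * ((j - k : ℤ) : ℝ) * Real.pi := by
    rw [h2]; simp
  have h4 : (1 : ℝ) ≤ |((j - k : ℤ) : ℝ)| := by
    exact_mod_cast Int.one_le_abs (sub_ne_zero.2 h)
  rw [h3, abs_mul, abs_mul, abs_of_pos Real.pi_pos] at h1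
  norm_num at h1 h4
  nlinarith [Real.pi_pos]

lemma isWanderingDomain_immediateBasin {l : ℝ} (hl0 : 0 < l) (hl2 : l < 2) (k : ℤ) :
    IsWanderingDomain (FMap l) (immediateBasin (fMap l) (fixedPt k)) := by
  have hperiodic : ∀ j : ℤ,
      ¬ IsPeriodicComponent (FMap l) (immediateBasin (fMap l) (fixedPt j)) := by
    rintro j ⟨-, p, hp, -, himg⟩
    have := himg ⟨fixedPt j, fixedPt_mem_immediateBasin l j, rfl⟩
    rw [iterate_FMap_fixedPt] at this
    exact fixedPt_notMem_immediateBasin hl0 (by omega) this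
  refine ⟨isFatouComponent_immediateBasin hl0 hl2 k, hperiodic k, ?_⟩
  rintro ⟨-, -, n, -, V, ⟨hVF, himg⟩, hVp⟩
  have hmem := himg ⟨fixedPt k, fixedPt_mem_immediateBasin l k, rfl⟩
  rw [iterate_FMap_fixedPt] at hmem
  have := hVF.eq_of_mem (isFatouComponent_immediateBasin hl0 hl2 (k + n)) hmem
    (fixedPt_mem_immediateBasin l _)
  exact hperiodic _ (this ▸ hVp)

lemma isEscaping_immediateBasin (l : ℝ) (k : ℤ) :
    IsEscaping (FMap l) (immediateBasin (fMap l) (fixedPt k)) := by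
  rw [immediateBasin_fMap]
  rintro _ ⟨z, hz, rfl⟩
  rw [← tendsto_norm_atTop_iff_cobounded]
  obtain ⟨M, hM⟩ := (Metric.isBounded_range_of_tendsto _
    (centredImmediateBasin_subset l hz)).exists_norm_le
  refine tendsto_atTop_mono (fun n => ?_) (tendsto_norm_fixedPt_add k M)
  have := norm_iterate_FMap_ge l k n z
  linarith [hM _ ⟨n, rfl⟩]

lemma not_isBounded_immediateBasin {l : ℝ} (hl0 : 0 < l) (hl2 : l < 2) (k : ℤ) :
    ¬ Bornology.IsBounded (immediateBasin (fMap l) (fixedPt k)) := by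
  rw [immediateBasin_fMap]
  intro hb
  obtain ⟨M, hM⟩ := hb.exists_norm_le
  have h1 := hM _ ⟨_, ofReal_mem_centredImmediateBasin hl0 hl2
    (x := -(|M| + 1)) (by linarith [abs_nonneg M]), rfl⟩
  have h2 := (Complex.abs_re_le_norm _).trans h1
  simp only [fixedPt] at h2
  simp at h2
  rw [abs_of_nonpos (by linarith [abs_nonneg M])] at h2
  linarith [le_abs_self M]

/-- A Fatou component that surrounds `0` at a distance greater than `π` has to meet the unbounded
Fatou component of `πi`. -/
lemma not_isBakerWanderingDomain_FMap {l : ℝ} (hl0 : 0 < l) (hl2 : l < 2) (D : Set ℂ) :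
    ¬ IsBakerWanderingDomain (FMap l) D := by
  rintro ⟨-, W, hW, hbd, ⟨N, hN⟩, hdist⟩
  obtain ⟨n, hnd, hnN⟩ := ((((tendsto_add_atTop_iff_nat 1).2 hdist).eventually_gt_atTop 4).and
    (eventually_ge_atTop N)).exists
  set B := immediateBasin (fMap l) (fixedPt 0)
  have hBF := isFatouComponent_immediateBasin hl0 hl2 0
  have hBunb := not_isBounded_immediateBasin hl0 hl2 0
  have hpB := fixedPt_mem_immediateBasin l 0
  have hdisj : Disjoint B (W (n + 1)) := by
    rw [Set.disjoint_left]
    intro z hzB hzW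
    exact hBunb ((hBF.eq_of_mem (hW (n + 1)).1 hzB hzW) ▸ hbd (n + 1))
  obtain ⟨C, hCb, ⟨z, hzC, hCeq⟩, h0C⟩ := (hN n hnN).2
  set X : Set ℂ := Metric.closedBall 0 4 ∪ B
  have hX : IsPreconnected X := by
    refine IsPreconnected.union (fixedPt 0) ?_ hpB (convex_closedBall _ _).isPreconnected
      isPreconnected_connectedComponentIn
    simp [fixedPt, abs_of_pos Real.pi_pos, Real.pi_le_four]
  have hXW : ((↑) '' X : Set (OnePoint ℂ)) ⊆ ((↑) '' W (n + 1))ᶜ := by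
    rintro _ ⟨w, hw, rfl⟩ ⟨w', hw', hww'⟩
    rw [OnePoint.coe_eq_coe] at hww'
    subst hww'
    rcases hw with hw | hw
    · have := Metric.infDist_le_dist_of_mem (x := (0 : ℂ)) hw'
      rw [Metric.mem_closedBall, dist_comm] at hw
      linarith
    · exact Set.disjoint_left.1 hdisj hw hw'
  have h0comp : ((0 : ℂ) : OnePoint ℂ) ∈
      connectedComponentIn ((↑) '' W (n + 1) : Set (OnePoint ℂ))ᶜ (z : OnePoint ℂ) := by
    rw [← hCeq]
    exact ⟨0, h0C rfl, rfl⟩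
  have hsub : ((↑) '' X : Set (OnePoint ℂ)) ⊆ (↑) '' C := by
    rw [hCeq, connectedComponentIn_eq h0comp]
    exact (hX.image _ OnePoint.continuous_coe.continuousOn).subset_connectedComponentIn
      ⟨0, Or.inl (by simp), rfl⟩ hXW
  refine hBunb (hCb.subset fun w hw => ?_)
  obtain ⟨w', hw', h⟩ := hsub ⟨w, Or.inr hw, rfl⟩
  rw [OnePoint.coe_eq_coe] at h
  exact h ▸ hw'

/-! ### Univalent functions and conformal discs -/

/-- An injective holomorphic function is open. -/
lemma image_mem_nhds_of_injOn {f : ℂ → ℂ} {U : Set ℂ} (hU : IsOpen U)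
    (hf : DifferentiableOn ℂ f U) (hinj : InjOn f U) {a : ℂ} (ha : a ∈ U) {S : Set ℂ}
    (hS : S ∈ 𝓝 a) : f '' S ∈ 𝓝 (f a) := by
  have han : AnalyticAt ℂ f a := hf.analyticAt (hU.mem_nhds ha)
  rcases han.eventually_constant_or_nhds_le_map_nhds with h | h
  · exfalso
    have h1 : ∀ᶠ z in 𝓝[≠] a, z ∈ U ∧ f z = f a :=
      nhdsWithin_le_nhds (Filter.Eventually.and (hU.mem_nhds ha) h)
    obtain ⟨z, ⟨hzU, hz⟩, hza⟩ := (h1.and self_mem_nhdsWithin).exists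
    exact hza (hinj hzU ha hz)
  · exact h (image_mem_map hS)

lemma isOpen_image_of_injOn {f : ℂ → ℂ} {U : Set ℂ} (hU : IsOpen U)
    (hf : DifferentiableOn ℂ f U) (hinj : InjOn f U) : IsOpen (f '' U) := by
  rw [isOpen_iff_mem_nhds]
  rintro _ ⟨a, ha, rfl⟩
  exact image_mem_nhds_of_injOn hU hf hinj ha (hU.mem_nhds ha)

lemma continuousAt_invFunOn {f : ℂ → ℂ} {U : Set ℂ} (hU : IsOpen U)
    (hf : DifferentiableOn ℂ f U) (hinj : InjOn f U) {a : ℂ} (ha : a ∈ U) :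
    ContinuousAt (Function.invFunOn f U) (f a) := by
  have hleft := hinj.leftInvOn_invFunOn
  rw [ContinuousAt, hleft ha]
  intro S hS
  rw [mem_map]
  refine mem_of_superset
    (image_mem_nhds_of_injOn hU hf hinj ha (inter_mem hS (hU.mem_nhds ha))) ?_
  rintro _ ⟨z, ⟨hzS, hzU⟩, rfl⟩
  rwa [mem_preimage, hleft hzU]

lemma eventually_apply_invFunOn {f : ℂ → ℂ} {U : Set ℂ} (hU : IsOpen U)
    (hf : DifferentiableOn ℂ f U) (hinj : InjOn f U) {a : ℂ} (ha : a ∈ U) :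
    ∀ᶠ w in 𝓝 (f a), f (Function.invFunOn f U w) = w := by
  filter_upwards [image_mem_nhds_of_injOn hU hf hinj ha (hU.mem_nhds ha)] with w hw
  exact Function.invFunOn_eq hw

lemma differentiableAt_invFunOn_of_deriv_ne_zero {f : ℂ → ℂ} {U : Set ℂ} (hU : IsOpen U)
    (hf : DifferentiableOn ℂ f U) (hinj : InjOn f U) {a : ℂ} (ha : a ∈ U) (hd : deriv f a ≠ 0) :
    DifferentiableAt ℂ (Function.invFunOn f U) (f a) := by
  have h1 := (hf.differentiableAt (hU.mem_nhds ha)).hasDerivAt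
  rw [← hinj.leftInvOn_invFunOn ha] at h1 hd
  exact (HasDerivAt.of_local_left_inverse (continuousAt_invFunOn hU hf hinj ha) h1
    (by rwa [hinj.leftInvOn_invFunOn ha] at hd ⊢)
    (eventually_apply_invFunOn hU hf hinj ha)).differentiableAt

/-- The inverse of an injective holomorphic function is holomorphic: off the isolated critical
values this is the inverse function theorem, and there the singularities are removable. -/
lemma differentiableAt_invFunOn {f : ℂ → ℂ} {U : Set ℂ} (hU : IsOpen U)
    (hf : DifferentiableOn ℂ f U) (hinj : InjOn f U) {a : ℂ} (ha : a ∈ U) :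
    DifferentiableAt ℂ (Function.invFunOn f U) (f a) := by
  have han : AnalyticAt ℂ (deriv f) a := (hf.analyticAt (hU.mem_nhds ha)).deriv
  rcases han.eventually_eq_zero_or_eventually_ne_zero with h | h
  · -- if the derivative vanishes identically, the function is locally constant
    exfalso
    obtain ⟨r, hr, hball⟩ := Metric.mem_nhds_iff.1 (inter_mem h (hU.mem_nhds ha))
    have hconst : ∀ z ∈ Metric.ball a r, f z = f a := by
      intro z hz
      refine (convex_ball a r).is_const_of_fderivWithin_eq_zero (𝕜 := ℂ)
        (hf.mono fun z hz => (hball hz).2) (fun z hz => ?_) hz (Metric.mem_ball_self hr)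
      rw [fderivWithin_of_isOpen Metric.isOpen_ball hz]
      ext
      simpa using (hball hz).1
    have h1 : ∀ᶠ z in 𝓝[≠] a, z ∈ Metric.ball a r :=
      nhdsWithin_le_nhds (Metric.ball_mem_nhds a hr)
    obtain ⟨z, hz, hza⟩ := (h1.and self_mem_nhdsWithin).exists
    exact hza (hinj (hball hz).2 ha (hconst z hz))
  · have hinv := continuousAt_invFunOn hU hf hinj ha
    refine (Complex.analyticAt_of_differentiable_on_punctured_nhds_of_continuousAt ?_
      hinv).differentiableAt
    have hleft := hinj.leftInvOn_invFunOn
    have h2 : ∀ᶠ z in 𝓝 a, z ≠ a → (z ∈ U ∧ deriv f z ≠ 0) := by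
      filter_upwards [eventually_nhdsWithin_iff.1 h, hU.mem_nhds ha] with z hz hzU hza
      exact ⟨hzU, hz hza⟩
    rw [ContinuousAt, hleft ha] at hinv
    rw [eventually_nhdsWithin_iff]
    filter_upwards [hinv.eventually h2, eventually_apply_invFunOn hU hf hinj ha] with w hw hfw hwne
    have hne : Function.invFunOn f U w ≠ a := fun h => hwne (by rw [← hfw, h]; rfl)
    obtain ⟨hwU, hwd⟩ := hw hne
    have := differentiableAt_invFunOn_of_deriv_ne_zero hU hf hinj hwU hwd
    rwa [hfw] at this

lemma deriv_ne_zero_of_injOn {f : ℂ → ℂ} {U : Set ℂ} (hU : IsOpen U)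
    (hf : DifferentiableOn ℂ f U) (hinj : InjOn f U) {a : ℂ} (ha : a ∈ U) : deriv f a ≠ 0 := by
  intro h0
  have h1 := (hf.differentiableAt (hU.mem_nhds ha)).hasDerivAt
  have h2 := (differentiableAt_invFunOn hU hf hinj ha).hasDerivAt.comp a h1
  rw [h0, mul_zero] at h2
  have h3 : HasDerivAt (Function.invFunOn f U ∘ f) 1 a := by
    refine (hasDerivAt_id a).congr_of_eventuallyEq ?_
    filter_upwards [hU.mem_nhds ha] with z hz
    exact hinj.leftInvOn_invFunOn hz
  exact zero_ne_one (h2.unique h3)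

/-- A conformal disc: the image of the unit disc under an injective holomorphic map. -/
def IsConformalDisc (V : Set ℂ) : Prop :=
  ∃ Φ : ℂ → ℂ, DifferentiableOn ℂ Φ (Metric.ball 0 1) ∧ InjOn Φ (Metric.ball 0 1) ∧
    Φ '' Metric.ball 0 1 = V

lemma isConformalDisc_ball (c : ℂ) {r : ℝ} (hr : 0 < r) : IsConformalDisc (Metric.ball c r) := by
  have hr' : (r : ℂ) ≠ 0 := by exact_mod_cast hr.ne'
  refine ⟨fun z => c + r * z, by fun_prop, fun z _ w _ h => ?_, ?_⟩
  · simpa [hr'] using h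
  · ext w
    constructor
    · rintro ⟨z, hz, rfl⟩
      rw [mem_ball_zero_iff] at hz
      simp [abs_of_pos hr]
      nlinarith
    · intro hw
      refine ⟨(w - c) / r, ?_, by field_simp; ring⟩
      rw [Metric.mem_ball, dist_eq_norm] at hw
      rw [mem_ball_zero_iff, norm_div, Complex.norm_real, Real.norm_of_nonneg hr.le,
        div_lt_one hr]
      exact hw

lemma IsConformalDisc.isOpen {V : Set ℂ} (hV : IsConformalDisc V) : IsOpen V := by
  obtain ⟨Φ, hd, hi, rfl⟩ := hV
  exact isOpen_image_of_injOn Metric.isOpen_ball hd hi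

lemma IsConformalDisc.isPreconnected {V : Set ℂ} (hV : IsConformalDisc V) : IsPreconnected V := by
  obtain ⟨Φ, hd, hi, rfl⟩ := hV
  exact (convex_ball _ _).isPreconnected.image _ hd.continuousOn

lemma IsConformalDisc.image {V : Set ℂ} (hV : IsConformalDisc V) {T : ℂ → ℂ}
    (hT : DifferentiableOn ℂ T V) (hTi : InjOn T V) : IsConformalDisc (T '' V) := by
  obtain ⟨Φ, hd, hi, rfl⟩ := hV
  exact ⟨T ∘ Φ, hT.comp hd (mapsTo_image _ _), hTi.comp hi (mapsTo_image _ _), image_comp _ _ _⟩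

lemma IsConformalDisc.isSimplyConnected {V : Set ℂ} (hV : IsConformalDisc V) :
    IsSimplyConnected V := by
  obtain ⟨Φ, hd, hi, rfl⟩ := hV
  let φ : Metric.ball (0 : ℂ) 1 → ℂ := fun z => Φ z
  have hφ : IsOpenEmbedding φ := by
    refine IsOpenEmbedding.of_continuous_injective_isOpenMap
      (continuousOn_iff_continuous_domRestrict.1 hd.continuousOn)
      (fun z w h => Subtype.ext (hi z.2 w.2 h)) ?_
    rw [isOpenMap_iff_nhds_le]
    intro z S hS
    rw [mem_map, mem_nhds_subtype_iff_nhdsWithin,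
      Metric.isOpen_ball.nhdsWithin_eq z.2] at hS
    refine mem_of_superset (image_mem_nhds_of_injOn Metric.isOpen_ball hd hi z.2
      (inter_mem hS (Metric.isOpen_ball.mem_nhds z.2))) ?_
    rintro _ ⟨w, ⟨⟨w', hw', rfl⟩, hw2⟩, rfl⟩
    exact hw'
  have hr : range φ = Φ '' Metric.ball 0 1 := by
    rw [image_eq_range]
  have : ContractibleSpace (Metric.ball (0 : ℂ) 1) :=
    (convex_ball (0 : ℂ) 1).contractibleSpace ⟨0, by simp⟩
  rw [← hr]
  exact hφ.isEmbedding.toHomeomorph.toHomotopyEquiv.simplyConnectedSpace_iff.1 inferInstance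

/-- The automorphism `z ↦ (z + a)/(1 + āz)` of the unit disc. -/
noncomputable def discShift (a z : ℂ) : ℂ := (z + a) / (1 + starRingEnd ℂ a * z)

lemma one_add_conj_mul_ne_zero {a z : ℂ} (ha : ‖a‖ < 1) (hz : ‖z‖ < 1) :
    1 + starRingEnd ℂ a * z ≠ 0 := by
  intro h
  have h1 : ‖starRingEnd ℂ a * z‖ = 1 := by
    rw [eq_neg_of_add_eq_zero_right h, norm_neg, norm_one]
  rw [norm_mul, Complex.norm_conj] at h1
  nlinarith [norm_nonneg a, norm_nonneg z]

lemma norm_discShift_lt_one {a z : ℂ} (ha : ‖a‖ < 1) (hz : ‖z‖ < 1) : ‖discShift a z‖ < 1 := by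
  rw [discShift, norm_div, div_lt_one (norm_pos_iff.2 (one_add_conj_mul_ne_zero ha hz)),
    ← sq_lt_sq₀ (norm_nonneg _) (norm_nonneg _), Complex.sq_norm, Complex.sq_norm,
    Complex.normSq_apply, Complex.normSq_apply]
  have h1 : a.re * a.re + a.im * a.im < 1 := by
    rw [← Complex.normSq_apply, ← Complex.sq_norm]; nlinarith [norm_nonneg a]
  have h2 : z.re * z.re + z.im * z.im < 1 := by
    rw [← Complex.normSq_apply, ← Complex.sq_norm]; nlinarith [norm_nonneg z]
  simp only [Complex.add_re, Complex.add_im, Complex.one_re, Complex.one_im, Complex.mul_re,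
    Complex.mul_im, Complex.conj_re, Complex.conj_im]
  nlinarith [mul_pos (sub_pos.2 h1) (sub_pos.2 h2)]

lemma discShift_neg_discShift {a z : ℂ} (ha : ‖a‖ < 1) (hz : ‖z‖ < 1) :
    discShift (-a) (discShift a z) = z := by
  have h1 := one_add_conj_mul_ne_zero ha hz
  have h2 : 1 + starRingEnd ℂ (-a) * discShift a z ≠ 0 :=
    one_add_conj_mul_ne_zero (by simpa using ha) (norm_discShift_lt_one ha hz)
  rw [discShift, div_eq_iff h2, discShift, map_neg]
  have e : (z + a) / (1 + starRingEnd ℂ a * z) * (1 + starRingEnd ℂ a * z) = z + a :=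
    div_mul_cancel₀ _ h1
  linear_combination e

/-- A conformal disc is parametrised by the unit disc with any of its points at the origin. -/
lemma IsConformalDisc.exists_param {V : Set ℂ} (hV : IsConformalDisc V) {v : ℂ} (hv : v ∈ V) :
    ∃ Φ : ℂ → ℂ, DifferentiableOn ℂ Φ (Metric.ball 0 1) ∧ InjOn Φ (Metric.ball 0 1) ∧
      Φ '' Metric.ball 0 1 = V ∧ Φ 0 = v := by
  obtain ⟨Φ, hd, hi, rfl⟩ := hV
  obtain ⟨a, ha, rfl⟩ := hv
  rw [mem_ball_zero_iff] at ha
  have hm : ∀ b : ℂ, ‖b‖ < 1 → MapsTo (discShift b) (Metric.ball 0 1) (Metric.ball 0 1) := by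
    intro b hb z hz
    rw [mem_ball_zero_iff] at hz ⊢
    exact norm_discShift_lt_one hb hz
  have hna : ‖-a‖ < 1 := by simpa using ha
  refine ⟨Φ ∘ discShift a, hd.comp ?_ (hm a ha), hi.comp ?_ (hm a ha), ?_, by simp [discShift]⟩
  · unfold discShift
    refine DifferentiableOn.div (by fun_prop) (by fun_prop) fun z hz => ?_
    exact one_add_conj_mul_ne_zero ha (mem_ball_zero_iff.1 hz)
  · intro z hz w hw h
    rw [mem_ball_zero_iff] at hz hw
    rw [← discShift_neg_discShift ha hz, h, discShift_neg_discShift ha hw]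
  · rw [image_comp]
    congr 1
    refine (hm a ha).image_subset.antisymm fun z hz => ?_
    refine ⟨discShift (-a) z, hm _ hna hz, ?_⟩
    have := discShift_neg_discShift hna (mem_ball_zero_iff.1 hz)
    rwa [neg_neg] at this

/-- The double cover of a conformal disc branched at one point is a conformal disc. -/
lemma IsConformalDisc.preimage_sq {V : Set ℂ} (hV : IsConformalDisc V) (h0 : (0 : ℂ) ∈ V) :
    IsConformalDisc {u : ℂ | u ^ 2 ∈ V} := by
  obtain ⟨Φ, hd, hi, rfl, hΦ0⟩ := hV.exists_param h0
  have h0m : (0 : ℂ) ∈ Metric.ball (0 : ℂ) 1 := by simp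
  have hsl : ∀ z, z * dslope Φ 0 z = Φ z := by
    intro z
    have := sub_smul_dslope Φ 0 z
    simpa [hΦ0] using this
  have hk : DifferentiableOn ℂ (dslope Φ 0) (Metric.ball 0 1) :=
    (Complex.differentiableOn_dslope (Metric.ball_mem_nhds 0 one_pos)).2 hd
  have hk0 : ∀ z ∈ Metric.ball (0 : ℂ) 1, dslope Φ 0 z ≠ 0 := by
    intro z hz h
    rcases eq_or_ne z 0 with rfl | hz0
    · rw [dslope_same] at h
      exact deriv_ne_zero_of_injOn Metric.isOpen_ball hd hi hz h
    · have h1 := hsl z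
      rw [h, mul_zero, ← hΦ0] at h1
      exact hz0 (hi hz h0m h1.symm)
  obtain ⟨w, hw, -, hexp⟩ := exists_log_on_ball one_pos hk hk0
  have hsqm : MapsTo (fun η : ℂ => η ^ 2) (Metric.ball 0 1) (Metric.ball 0 1) := by
    intro η hη
    rw [mem_ball_zero_iff] at hη ⊢
    rw [norm_pow]
    exact pow_lt_one₀ (norm_nonneg _) hη two_ne_zero
  set Ψ : ℂ → ℂ := fun η => η * Complex.exp (w (η ^ 2) / 2)
  have hΨ : ∀ η ∈ Metric.ball (0 : ℂ) 1, Ψ η ^ 2 = Φ (η ^ 2) := by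
    intro η hη
    rw [← hsl, ← hexp _ (hsqm hη), mul_pow, ← Complex.exp_nat_mul]
    congr 2
    push_cast; ring
  have hneg : ∀ η, Ψ (-η) = -Ψ η := fun η => by simp [Ψ]
  refine ⟨Ψ, ?_, ?_, ?_⟩
  · have hw2 : DifferentiableOn ℂ (fun η => w (η ^ 2)) (Metric.ball 0 1) :=
      hw.comp (by fun_prop) hsqm
    exact differentiableOn_id.mul (hw2.div_const 2).cexp
  · intro η hη η' hη' h
    have h1 : Φ (η ^ 2) = Φ (η' ^ 2) := by rw [← hΨ η hη, ← hΨ η' hη', h]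
    have h2 := hi (hsqm hη) (hsqm hη') h1
    rcases sq_eq_sq_iff_eq_or_eq_neg.1 h2 with h3 | h3
    · exact h3
    · rw [h3, hneg] at h
      have h4 : Ψ η' = 0 := by linear_combination -h / 2
      have h5 : η' = 0 := by simpa [Ψ, Complex.exp_ne_zero] using h4
      rw [h3, h5, neg_zero]
  · ext u
    constructor
    · rintro ⟨η, hη, rfl⟩
      exact ⟨η ^ 2, hsqm hη, (hΨ η hη).symm⟩
    · rintro ⟨ζ, hζ, hζu⟩
      obtain ⟨η, rfl⟩ := IsAlgClosed.exists_pow_nat_eq ζ two_pos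
      have hη : η ∈ Metric.ball (0 : ℂ) 1 := by
        rw [mem_ball_zero_iff, norm_pow] at hζ
        rw [mem_ball_zero_iff]
        by_contra hge
        exact absurd hζ (not_lt.2 (one_le_pow₀ (not_lt.1 hge)))
      have h1 : Ψ η ^ 2 = u ^ 2 := (hΨ η hη).trans hζu
      rcases sq_eq_sq_iff_eq_or_eq_neg.1 h1 with h2 | h2
      · exact ⟨η, hη, h2⟩
      · exact ⟨-η, by simpa using hη, by rw [hneg, h2, neg_neg]⟩

/-- The square root splits over a conformal disc that does not contain `0`. -/
lemma IsConformalDisc.exists_sqrt {V : Set ℂ} (hV : IsConformalDisc V) (h0 : (0 : ℂ) ∉ V) :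
    ∃ W : Set ℂ, IsConformalDisc W ∧ Disjoint W (-W) ∧ {u : ℂ | u ^ 2 ∈ V} = W ∪ -W := by
  obtain ⟨Φ, hd, hi, rfl⟩ := hV
  obtain ⟨w, hw, -, hexp⟩ := exists_log_on_ball one_pos hd
    (fun z hz h => h0 ⟨z, hz, h⟩)
  set q : ℂ → ℂ := fun η => Complex.exp (w η / 2)
  have hq : ∀ η ∈ Metric.ball (0 : ℂ) 1, q η ^ 2 = Φ η := by
    intro η hη
    rw [← hexp η hη, ← Complex.exp_nat_mul]
    congr 1
    push_cast; ring
  refine ⟨q '' Metric.ball 0 1, ⟨q, (hw.div_const 2).cexp, ?_, rfl⟩, ?_, ?_⟩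
  · intro η hη η' hη' h
    exact hi hη hη' (by rw [← hq η hη, ← hq η' hη', h])
  · rw [Set.disjoint_left]
    rintro _ ⟨η, hη, rfl⟩ ⟨η', hη', h⟩
    have h1 : η' = η := hi hη' hη (by rw [← hq η hη, ← hq η' hη', h, neg_sq])
    rw [h1] at h
    have h2 : q η = 0 := by linear_combination h / 2
    exact Complex.exp_ne_zero _ h2
  · ext u
    constructor
    · rintro ⟨η, hη, h⟩
      rw [← hq η hη] at h
      rcases sq_eq_sq_iff_eq_or_eq_neg.1 h with h2 | h2
      · exact Or.inl ⟨η, hη, h2⟩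
      · exact Or.inr ⟨η, hη, h2⟩
    · rintro (⟨η, hη, h⟩ | ⟨η, hη, h⟩)
      · exact ⟨η, hη, by rw [← hq η hη, h]⟩
      · exact ⟨η, hη, by rw [← hq η hη, h, neg_sq]⟩

/-- An increasing union of open simply connected sets is simply connected. -/
lemma isSimplyConnected_iUnion_of_monotone {X : Type*} [TopologicalSpace X] {U : ℕ → Set X}
    (hm : Monotone U) (ho : ∀ n, IsOpen (U n)) (hs : ∀ n, IsSimplyConnected (U n)) :
    IsSimplyConnected (⋃ n, U n) := by
  rw [isSimplyConnected_iff_exists_homotopy_refl_forall_mem]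
  constructor
  · obtain ⟨x, hx⟩ := (hs 0).nonempty
    refine ⟨x, mem_iUnion.2 ⟨0, hx⟩, fun y hy => ?_⟩
    obtain ⟨n, hn⟩ := mem_iUnion.1 hy
    exact ((hs n).isPathConnected.joinedIn x (hm n.zero_le hx) y hn).mono (subset_iUnion U n)
  · intro x p hp
    have hc : IsCompact (range p) := isCompact_range p.continuous
    obtain ⟨n, hn⟩ := hc.elim_directed_cover U ho (by rintro _ ⟨t, rfl⟩; exact hp t)
      hm.directed_le
    obtain ⟨F, hF⟩ := (isSimplyConnected_iff_exists_homotopy_refl_forall_mem.1 (hs n)).2 x p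
      (fun t => hn ⟨t, rfl⟩)
    exact ⟨F, fun t => mem_iUnion.2 ⟨n, hF t⟩⟩

/-! ### The map on the strip is a double cover branched at one point -/

/-- The critical value of the centred map that belongs to its critical point `-log λ`. -/
noncomputable def critValue (l : ℝ) : ℝ := l - 1 - Real.log l

/-- If `z = x + iv` with `0 < v < π` is mapped to a point of imaginary part `τ`, then `x` is
determined by `v` and `τ`, and the real part of the image is `heightFun τ v + λ - log λ`. -/
noncomputable def heightFun (τ v : ℝ) : ℝ :=
  Real.log ((v - τ) / Real.sin v) - (v - τ) * (Real.cos v / Real.sin v)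

lemma hasDerivAt_heightFun {τ v : ℝ} (h0 : 0 < v) (hπ : v < Real.pi) (hτ : τ < v) :
    HasDerivAt (heightFun τ)
      (((v - τ - Real.sin v * Real.cos v) ^ 2 + Real.sin v ^ 4) /
        ((v - τ) * Real.sin v ^ 2)) v := by
  have hs := Real.sin_pos_of_pos_of_lt_pi h0 hπ
  have ha : 0 < v - τ := sub_pos.2 hτ
  have h1 : HasDerivAt (fun v => v - τ) 1 v := (hasDerivAt_id v).sub_const τ
  have h2 := (h1.div (Real.hasDerivAt_sin v) hs.ne').log (div_pos ha hs).ne'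
  have h3 := h1.mul ((Real.hasDerivAt_cos v).div (Real.hasDerivAt_sin v) hs.ne')
  refine (h2.sub h3).congr_deriv ?_
  simp only [Pi.div_apply]
  have h4 := Real.sin_sq_add_cos_sq v
  field_simp
  linear_combination (-(Real.sin v ^ 2) + (v - τ) ^ 2) * h4

lemma strictMonoOn_heightFun (τ : ℝ) : StrictMonoOn (heightFun τ) (Ioo (max τ 0) Real.pi) := by
  have hd : ∀ v ∈ Ioo (max τ 0) Real.pi, HasDerivAt (heightFun τ)
      (((v - τ - Real.sin v * Real.cos v) ^ 2 + Real.sin v ^ 4) / ((v - τ) * Real.sin v ^ 2)) v :=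
    fun v hv => hasDerivAt_heightFun ((le_max_right _ _).trans_lt hv.1) hv.2
      ((le_max_left _ _).trans_lt hv.1)
  refine strictMonoOn_of_deriv_pos (convex_Ioo _ _)
    (fun v hv => (hd v hv).continuousAt.continuousWithinAt) fun v hv => ?_
  rw [interior_Ioo] at hv
  rw [(hd v hv).deriv]
  have hs := Real.sin_pos_of_pos_of_lt_pi ((le_max_right _ _).trans_lt hv.1) hv.2
  have ha : 0 < v - τ := sub_pos.2 ((le_max_left _ _).trans_lt hv.1)
  positivity

lemma continuousOn_heightFun (τ : ℝ) : ContinuousOn (heightFun τ) (Ioo (max τ 0) Real.pi) :=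
  fun _ hv => (hasDerivAt_heightFun ((le_max_right _ _).trans_lt hv.1) hv.2
    ((le_max_left _ _).trans_lt hv.1)).continuousAt.continuousWithinAt

/-- The upper half of the strip `|Im z| < π`. -/
def upperStrip : Set ℂ := {z | 0 < z.im ∧ z.im < Real.pi}

lemma sin_im_pos {z : ℂ} (hz : z ∈ upperStrip) : 0 < Real.sin z.im :=
  Real.sin_pos_of_pos_of_lt_pi hz.1 hz.2

lemma im_sub_im_centredMap (l : ℝ) (z : ℂ) :
    z.im - (centredMap l z).im = l * (Real.exp z.re * Real.sin z.im) := by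
  rw [centredMap_im]; ring

lemma im_centredMap_lt {l : ℝ} (hl0 : 0 < l) {z : ℂ} (hz : z ∈ upperStrip) :
    (centredMap l z).im < z.im := by
  have := im_sub_im_centredMap l z
  have := sin_im_pos hz
  have : 0 < l * (Real.exp z.re * Real.sin z.im) := by positivity
  linarith

lemma re_eq_log_of_mem_upperStrip {l : ℝ} (hl0 : 0 < l) {z : ℂ} (hz : z ∈ upperStrip) :
    z.re = Real.log ((z.im - (centredMap l z).im) / Real.sin z.im) - Real.log l := by
  have hs := sin_im_pos hz
  rw [im_sub_im_centredMap, ← mul_assoc, mul_div_cancel_right₀ _ hs.ne',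
    Real.log_mul hl0.ne' (Real.exp_pos _).ne', Real.log_exp]
  ring

lemma re_centredMap_eq_heightFun {l : ℝ} (hl0 : 0 < l) {z : ℂ} (hz : z ∈ upperStrip) :
    (centredMap l z).re = heightFun (centredMap l z).im z.im + l - Real.log l := by
  have hs := sin_im_pos hz
  have h1 := re_eq_log_of_mem_upperStrip hl0 hz
  have h2 : (z.im - (centredMap l z).im) * (Real.cos z.im / Real.sin z.im)
      = l * (Real.exp z.re * Real.cos z.im) := by
    rw [im_sub_im_centredMap]; field_simp
  rw [heightFun, h2, centredMap_re]
  linarith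

lemma injOn_centredMap_upperStrip {l : ℝ} (hl0 : 0 < l) :
    InjOn (centredMap l) upperStrip := by
  intro z hz w hw h
  have hz' : z.im ∈ Ioo (max (centredMap l z).im 0) Real.pi :=
    ⟨max_lt (im_centredMap_lt hl0 hz) hz.1, hz.2⟩
  have hw' : w.im ∈ Ioo (max (centredMap l z).im 0) Real.pi :=
    ⟨max_lt (h ▸ im_centredMap_lt hl0 hw) hw.1, hw.2⟩
  have h1 := re_centredMap_eq_heightFun hl0 hz
  have h2 := re_centredMap_eq_heightFun hl0 hw
  rw [← h] at h2
  have him : z.im = w.im := (strictMonoOn_heightFun _).injOn hz' hw' (by linarith)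
  refine Complex.ext ?_ him
  rw [re_eq_log_of_mem_upperStrip hl0 hz, re_eq_log_of_mem_upperStrip hl0 hw, h, him]

lemma mul_cos_lt_sin {v : ℝ} (h0 : 0 < v) (hπ : v < Real.pi) : v * Real.cos v < Real.sin v := by
  have hs := Real.sin_pos_of_pos_of_lt_pi h0 hπ
  rcases lt_or_ge v (Real.pi / 2) with h | h
  · have hc : 0 < Real.cos v := Real.cos_pos_of_mem_Ioo ⟨by linarith, h⟩
    have := Real.lt_tan h0 h
    rwa [Real.tan_eq_sin_div_cos, lt_div_iff₀ hc] at this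
  · have hc : Real.cos v ≤ 0 := Real.cos_nonpos_of_pi_div_two_le_of_le h (by linarith)
    nlinarith

/-- The upper half of the strip is mapped off the ray from the critical value to `-∞`. -/
lemma sub_critValue_mem_slitPlane {l : ℝ} (hl0 : 0 < l) {z : ℂ} (hz : z ∈ upperStrip) :
    centredMap l z - critValue l ∈ Complex.slitPlane := by
  rw [Complex.mem_slitPlane_iff]
  by_cases him : (centredMap l z).im = 0
  · left
    have hs := sin_im_pos hz
    have h1 := re_centredMap_eq_heightFun hl0 hz
    rw [him, heightFun, sub_zero] at h1
    have h2 : 0 ≤ Real.log (z.im / Real.sin z.im) :=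
      Real.log_nonneg ((one_le_div hs).2 (Real.sin_lt hz.1).le)
    have h3 : z.im * (Real.cos z.im / Real.sin z.im) < 1 := by
      rw [← mul_div_assoc, div_lt_one hs]
      exact mul_cos_lt_sin hz.1 hz.2
    simp only [Complex.sub_re, Complex.ofReal_re, critValue]
    linarith
  · right
    simpa using him

lemma tendsto_sin_nhdsGT_zero : Tendsto Real.sin (𝓝[>] 0) (𝓝[>] 0) := by
  refine tendsto_nhdsWithin_iff.2 ⟨?_, ?_⟩
  · exact (Real.continuous_sin.tendsto' 0 0 Real.sin_zero).mono_left nhdsWithin_le_nhds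
  · filter_upwards [Ioo_mem_nhdsGT Real.pi_pos] with v hv
    exact Real.sin_pos_of_pos_of_lt_pi hv.1 hv.2

lemma exists_heightFun_lt {τ σ : ℝ} (hτ : |τ| < Real.pi) (h : τ = 0 → -1 < σ) :
    ∃ v ∈ Ioo (max τ 0) Real.pi, heightFun τ v < σ := by
  rw [abs_lt] at hτ
  suffices h : ∀ᶠ v in 𝓝[>] (max τ 0), heightFun τ v < σ by
    obtain ⟨v, hv1, hv2⟩ := (h.and (Ioo_mem_nhdsGT (max_lt hτ.2 Real.pi_pos))).exists
    exact ⟨v, hv2, hv1⟩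
  rcases lt_trichotomy τ 0 with hneg | rfl | hpos
  · -- as `v → 0` the term `(τ - v) cot v` tends to `-∞` and dominates the logarithm
    rw [max_eq_right hneg.le]
    have hsin := tendsto_sin_nhdsGT_zero
    have hinv : Tendsto (fun v : ℝ => (Real.sin v)⁻¹) (𝓝[>] 0) atTop :=
      tendsto_inv_nhdsGT_zero.comp hsin
    have hcoef : Tendsto (fun v : ℝ => (v - τ) * Real.cos v) (𝓝[>] 0) (𝓝 (-τ)) := by
      refine Tendsto.mono_left ?_ nhdsWithin_le_nhds
      have : Continuous fun v : ℝ => (v - τ) * Real.cos v := by fun_prop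
      exact this.tendsto' _ _ (by simp)
    have hid : Tendsto (fun v : ℝ => v) (𝓝[>] 0) (𝓝 0) := tendsto_id.mono_left nhdsWithin_le_nhds
    have h1 : ∀ᶠ y : ℝ in atTop, Real.log y ≤ (-τ / 4) * y := by
      have := Real.isLittleO_log_id_atTop.def (show 0 < -τ / 4 by linarith)
      filter_upwards [this, eventually_ge_atTop 0] with y hy hy0
      rw [id, Real.norm_of_nonneg hy0] at hy
      exact (le_abs_self _).trans hy
    have h2 : ∀ᶠ y : ℝ in atTop, Real.log (-2 * τ) - (-τ / 4) * y < σ := by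
      have : Tendsto (fun y : ℝ => (-τ / 4) * y) atTop atTop :=
        tendsto_id.const_mul_atTop (by linarith)
      filter_upwards [this.eventually_gt_atTop (Real.log (-2 * τ) - σ)] with y hy
      linarith
    filter_upwards [hinv.eventually h1, hinv.eventually h2, hinv.eventually_gt_atTop 0,
      hcoef.eventually (lt_mem_nhds (show -τ / 2 < -τ by linarith)),
      hid.eventually (gt_mem_nhds (show 0 < -τ by linarith)),
      self_mem_nhdsWithin] with v hv1 hv2 hv3 hv4 hv5 hv6
    have hv6' : 0 < v := hv6
    rw [heightFun, div_eq_mul_inv, Real.log_mul (by linarith) hv3.ne']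
    have h3 : Real.log (v - τ) ≤ Real.log (-2 * τ) :=
      Real.log_le_log (by linarith) (by linarith)
    have h4 : (-τ / 2) * (Real.sin v)⁻¹ ≤ (v - τ) * (Real.cos v / Real.sin v) := by
      rw [← mul_div_assoc, div_eq_mul_inv]
      exact mul_le_mul_of_nonneg_right hv4.le hv3.le
    linarith
  · -- as `v → 0` both `v / sin v` and `v cot v` tend to `1`
    rw [max_self]
    have hdiv : Tendsto (fun v : ℝ => v / Real.sin v) (𝓝[>] 0) (𝓝 1) := by
      have h1 : Tendsto (fun v : ℝ => v⁻¹ * (Real.sin (0 + v) - Real.sin 0)) (𝓝[≠] 0) (𝓝 1) := by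
        simpa using (Real.hasDerivAt_sin 0).tendsto_slope_zero
      have h2 := (h1.mono_left (nhdsGT_le_nhdsNE 0)).inv₀ one_ne_zero
      rw [inv_one] at h2
      refine h2.congr fun v => ?_
      simp [div_eq_mul_inv, mul_comm]
    have hcos : Tendsto Real.cos (𝓝[>] 0) (𝓝 1) :=
      (Real.continuous_cos.tendsto' 0 1 Real.cos_zero).mono_left nhdsWithin_le_nhds
    have hlim : Tendsto (heightFun 0) (𝓝[>] 0) (𝓝 (-1)) := by
      have := ((Real.continuousAt_log one_ne_zero).tendsto.comp hdiv).sub (hdiv.mul hcos)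
      rw [Real.log_one, mul_one, zero_sub] at this
      refine this.congr fun v => ?_
      simp only [heightFun, Function.comp, sub_zero]
      ring
    exact hlim.eventually (gt_mem_nhds (h rfl))
  · -- as `v → τ` the logarithm tends to `-∞`
    rw [max_eq_left hpos.le]
    have hs : 0 < Real.sin τ := Real.sin_pos_of_pos_of_lt_pi hpos hτ.2
    have h1 : Tendsto (fun v : ℝ => (v - τ) / Real.sin v) (𝓝[>] τ) (𝓝[>] 0) := by
      refine tendsto_nhdsWithin_iff.2 ⟨?_, ?_⟩
      · refine Tendsto.mono_left ?_ nhdsWithin_le_nhds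
        have : ContinuousAt (fun v : ℝ => (v - τ) / Real.sin v) τ :=
          ContinuousAt.div (by fun_prop) (by fun_prop) hs.ne'
        simpa [ContinuousAt] using this
      · filter_upwards [Ioo_mem_nhdsGT hτ.2] with v hv
        exact div_pos (sub_pos.2 hv.1) (Real.sin_pos_of_pos_of_lt_pi (hpos.trans hv.1) hv.2)
    have h2 : Tendsto (fun v : ℝ => (v - τ) * (Real.cos v / Real.sin v)) (𝓝[>] τ) (𝓝 0) := by
      refine Tendsto.mono_left ?_ nhdsWithin_le_nhds
      have : ContinuousAt (fun v : ℝ => (v - τ) * (Real.cos v / Real.sin v)) τ :=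
        ContinuousAt.mul (by fun_prop) (ContinuousAt.div (by fun_prop) (by fun_prop) hs.ne')
      simpa [ContinuousAt] using this
    have h3 := (Real.tendsto_log_nhdsGT_zero.comp h1).atBot_add h2.neg
    filter_upwards [h3.eventually_lt_atBot σ] with v hv
    simpa [heightFun, sub_eq_add_neg] using hv

lemma exists_lt_heightFun {τ : ℝ} (hτ : |τ| < Real.pi) (σ : ℝ) :
    ∃ v ∈ Ioo (max τ 0) Real.pi, σ < heightFun τ v := by
  rw [abs_lt] at hτ
  have hlt := max_lt hτ.2 Real.pi_pos
  suffices h : ∀ᶠ v in 𝓝[<] Real.pi, σ < heightFun τ v by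
    obtain ⟨v, hv1, hv2⟩ := (h.and (Ioo_mem_nhdsLT hlt)).exists
    exact ⟨v, hv2, hv1⟩
  have hsin : Tendsto Real.sin (𝓝[<] Real.pi) (𝓝[>] 0) := by
    refine tendsto_nhdsWithin_iff.2 ⟨?_, ?_⟩
    · exact (Real.continuous_sin.tendsto' _ 0 Real.sin_pi).mono_left nhdsWithin_le_nhds
    · filter_upwards [Ioo_mem_nhdsLT Real.pi_pos] with v hv
      exact Real.sin_pos_of_pos_of_lt_pi hv.1 hv.2
  have h1 : Tendsto (fun v : ℝ => (v - τ) / Real.sin v) (𝓝[<] Real.pi) atTop := by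
    have h2 : Tendsto (fun v : ℝ => v - τ) (𝓝[<] Real.pi) (𝓝 (Real.pi - τ)) :=
      ((continuous_id.sub continuous_const).tendsto Real.pi).mono_left nhdsWithin_le_nhds
    exact h2.pos_mul_atTop (sub_pos.2 hτ.2) (tendsto_inv_nhdsGT_zero.comp hsin)
  have hpi2 : Real.pi / 2 < Real.pi := by linarith [Real.pi_pos]
  filter_upwards [(Real.tendsto_log_atTop.comp h1).eventually_gt_atTop σ,
    Ioo_mem_nhdsLT hlt, Ioo_mem_nhdsLT hpi2] with v hv1 hv2 hv3
  have hs : 0 < Real.sin v :=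
    Real.sin_pos_of_pos_of_lt_pi ((le_max_right _ _).trans_lt hv2.1) hv2.2
  have hc : Real.cos v ≤ 0 :=
    Real.cos_nonpos_of_pi_div_two_le_of_le hv3.1.le (by linarith [hv3.2, Real.pi_pos])
  have ha : 0 < v - τ := sub_pos.2 ((le_max_left _ _).trans_lt hv2.1)
  have h4 : (v - τ) * (Real.cos v / Real.sin v) ≤ 0 :=
    mul_nonpos_of_nonneg_of_nonpos ha.le (div_nonpos_of_nonpos_of_nonneg hc hs.le)
  simp only [Function.comp] at hv1
  rw [heightFun]
  linarith

/-- The upper half of the strip is mapped onto the slit strip. -/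
lemma exists_mem_upperStrip_centredMap_eq {l : ℝ} (hl0 : 0 < l) {t : ℂ} (ht : t ∈ strip)
    (hslit : t - critValue l ∈ Complex.slitPlane) :
    ∃ z ∈ upperStrip, centredMap l z = t := by
  have hτ : |t.im| < Real.pi := ht
  set σ := t.re - l + Real.log l
  have hσ : t.im = 0 → -1 < σ := by
    intro h0
    rw [Complex.mem_slitPlane_iff] at hslit
    rcases hslit with h | h
    · simp only [Complex.sub_re, Complex.ofReal_re, critValue] at h
      simp only [σ]; linarith
    · simp [h0] at h
  obtain ⟨v₁, hv₁, h₁⟩ := exists_heightFun_lt hτ hσ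
  obtain ⟨v₂, hv₂, h₂⟩ := exists_lt_heightFun hτ σ
  obtain ⟨v, hv, hvσ⟩ := (isPreconnected_Ioo.image _ (continuousOn_heightFun t.im)).Icc_subset
    ⟨v₁, hv₁, rfl⟩ ⟨v₂, hv₂, rfl⟩ ⟨h₁.le, h₂.le⟩
  have h0 : 0 < v := (le_max_right _ _).trans_lt hv.1
  have ha : 0 < v - t.im := sub_pos.2 ((le_max_left _ _).trans_lt hv.1)
  have hs := Real.sin_pos_of_pos_of_lt_pi h0 hv.2
  set x := Real.log ((v - t.im) / Real.sin v) - Real.log l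
  have hx : l * Real.exp x = (v - t.im) / Real.sin v := by
    simp only [x]
    rw [Real.exp_sub, Real.exp_log (div_pos ha hs), Real.exp_log hl0]
    field_simp
  refine ⟨⟨x, v⟩, ⟨h0, hv.2⟩, Complex.ext ?_ ?_⟩
  · rw [centredMap_re]
    change x + l - l * (Real.exp x * Real.cos v) = t.re
    rw [← mul_assoc, hx]
    simp only [heightFun] at hvσ
    simp only [x, σ] at *
    rw [show (v - t.im) / Real.sin v * Real.cos v = (v - t.im) * (Real.cos v / Real.sin v) by ring]
    linarith
  · rw [centredMap_im]
    change v - l * (Real.exp x * Real.sin v) = t.im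
    rw [← mul_assoc, hx]
    field_simp
    ring

/-! ### A holomorphic square root of the centred map minus its critical value -/

lemma sqrt_sq (w : ℂ) : Complex.sqrt w ^ 2 = w := by
  have := Complex.cpow_nat_inv_pow w two_ne_zero
  exact_mod_cast this

lemma sqrt_re_nonneg (w : ℂ) : 0 ≤ (Complex.sqrt w).re := by
  rw [Complex.sqrt, Complex.cpow_inv_two_re]
  exact Real.sqrt_nonneg _

lemma sqrt_re_pos {w : ℂ} (hw : w ∈ Complex.slitPlane) : 0 < (Complex.sqrt w).re := by
  rw [Complex.sqrt, Complex.cpow_inv_two_re]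
  refine Real.sqrt_pos.2 (div_pos ?_ two_pos)
  rcases Complex.mem_slitPlane_iff.1 hw with h | h
  · have := norm_nonneg w
    linarith
  · have := Complex.abs_re_lt_norm.2 h
    linarith [neg_abs_le w.re]

lemma eq_of_sq_eq_of_re_pos {u v : ℂ} (h : u ^ 2 = v ^ 2) (hu : 0 < u.re) (hv : 0 < v.re) :
    u = v := by
  rcases sq_eq_sq_iff_eq_or_eq_neg.1 h with h | h
  · exact h
  · rw [h, Complex.neg_re] at hu
    linarith

lemma im_sqrt_mul_re (w : ℂ) : 2 * ((Complex.sqrt w).re * (Complex.sqrt w).im) = w.im := by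
  have := congrArg Complex.im (sqrt_sq w)
  rw [sq, Complex.mul_im] at this
  linarith

/-- Above the real axis `√w = i√(-w)`. -/
lemma sqrt_eq_I_mul_of_im_pos {w : ℂ} (hw : 0 < w.im) :
    Complex.sqrt w = Complex.I * Complex.sqrt (-w) := by
  refine eq_of_sq_eq_of_re_pos ?_ (sqrt_re_pos (Or.inr hw.ne')) ?_
  · rw [mul_pow, sqrt_sq, sqrt_sq, Complex.I_sq]; ring
  · have h1 := im_sqrt_mul_re (-w)
    have h2 := sqrt_re_nonneg (-w)
    rw [Complex.neg_im] at h1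
    rw [Complex.I_mul_re]
    by_contra hle
    nlinarith

/-- Below the real axis `√w = -i√(-w)`. -/
lemma sqrt_eq_neg_I_mul_of_im_neg {w : ℂ} (hw : w.im < 0) :
    Complex.sqrt w = -(Complex.I * Complex.sqrt (-w)) := by
  refine eq_of_sq_eq_of_re_pos ?_ (sqrt_re_pos (Or.inr hw.ne)) ?_
  · rw [neg_sq, mul_pow, sqrt_sq, sqrt_sq, Complex.I_sq]; ring
  · have h1 := im_sqrt_mul_re (-w)
    have h2 := sqrt_re_nonneg (-w)
    rw [Complex.neg_im] at h1
    rw [Complex.neg_re, Complex.I_mul_re]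
    by_contra hle
    nlinarith

/-- The real map `x ↦ x + λ - λe^x`, the restriction of the centred map to the real axis. -/
noncomputable def realMap (l x : ℝ) : ℝ := x + l - l * Real.exp x

lemma hasDerivAt_realMap (l x : ℝ) : HasDerivAt (realMap l) (1 - l * Real.exp x) x := by
  unfold realMap
  exact ((hasDerivAt_id x).add_const _).sub ((Real.hasDerivAt_exp x).const_mul _)

lemma continuous_realMap (l : ℝ) : Continuous (realMap l) := by
  unfold realMap; fun_prop

lemma realMap_critPoint {l : ℝ} (hl0 : 0 < l) : realMap l (-Real.log l) = critValue l := by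
  rw [realMap, critValue, Real.exp_neg, Real.exp_log hl0]
  field_simp
  ring

lemma strictMonoOn_realMap {l : ℝ} (hl0 : 0 < l) :
    StrictMonoOn (realMap l) (Iic (-Real.log l)) := by
  refine strictMonoOn_of_deriv_pos (convex_Iic _) (continuous_realMap l).continuousOn
    fun x hx => ?_
  rw [interior_Iic, mem_Iio] at hx
  rw [(hasDerivAt_realMap l x).deriv]
  have h1 := Real.exp_lt_exp.2 hx
  rw [Real.exp_neg, Real.exp_log hl0] at h1
  have h2 := mul_lt_mul_of_pos_left h1 hl0
  rw [mul_inv_cancel₀ hl0.ne'] at h2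
  linarith

lemma strictAntiOn_realMap {l : ℝ} (hl0 : 0 < l) :
    StrictAntiOn (realMap l) (Ici (-Real.log l)) := by
  refine strictAntiOn_of_deriv_neg (convex_Ici _) (continuous_realMap l).continuousOn
    fun x hx => ?_
  rw [interior_Ici, mem_Ioi] at hx
  rw [(hasDerivAt_realMap l x).deriv]
  have h1 := Real.exp_lt_exp.2 hx
  rw [Real.exp_neg, Real.exp_log hl0] at h1
  have h2 := mul_lt_mul_of_pos_left h1 hl0
  rw [mul_inv_cancel₀ hl0.ne'] at h2
  linarith

lemma realMap_lt_critValue {l x : ℝ} (hl0 : 0 < l) (hx : x ≠ -Real.log l) :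
    realMap l x < critValue l := by
  rw [← realMap_critPoint hl0]
  rcases lt_or_gt_of_ne hx with h | h
  · exact strictMonoOn_realMap hl0 h.le self_mem_Iic h
  · exact strictAntiOn_realMap hl0 self_mem_Ici h.le h

lemma realMap_le_critValue {l : ℝ} (hl0 : 0 < l) (x : ℝ) : realMap l x ≤ critValue l := by
  rcases eq_or_ne x (-Real.log l) with rfl | h
  · exact (realMap_critPoint hl0).le
  · exact (realMap_lt_critValue hl0 h).le

lemma exists_le_realMap_eq {l t : ℝ} (hl0 : 0 < l) (ht : t ≤ critValue l) :
    ∃ x ≤ -Real.log l, realMap l x = t := by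
  have h1 : Tendsto (realMap l) atBot atBot := by
    refine tendsto_atBot_mono (fun x => ?_) (tendsto_atBot_add_const_right atBot l tendsto_id)
    have := Real.exp_pos x
    simp only [realMap, id]
    nlinarith
  obtain ⟨a, ha, hac⟩ := ((h1.eventually_le_atBot t).and (eventually_le_atBot (-Real.log l))).exists
  obtain ⟨x, hx, hxt⟩ := intermediate_value_Icc hac (continuous_realMap l).continuousOn
    ⟨ha, ht.trans (realMap_critPoint hl0).ge⟩
  exact ⟨x, hx.2, hxt⟩

lemma exists_ge_realMap_eq {l t : ℝ} (hl0 : 0 < l) (ht : t ≤ critValue l) :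
    ∃ x, -Real.log l ≤ x ∧ realMap l x = t := by
  have h1 : Tendsto (realMap l) atTop atBot := by
    have h2 : ∀ᶠ x : ℝ in atTop, realMap l x ≤ l - x := by
      have := (Real.tendsto_exp_div_pow_atTop 1).eventually_ge_atTop (2 / l)
      filter_upwards [this, eventually_gt_atTop 0] with x hx hx0
      rw [pow_one, le_div_iff₀ hx0, div_mul_eq_mul_div, div_le_iff₀ hl0] at hx
      simp only [realMap]
      linarith
    exact tendsto_atBot_mono' _ h2 (tendsto_atBot_add_const_left _ _ tendsto_neg_atTop_atBot)
  obtain ⟨b, hb, hbc⟩ := ((h1.eventually_le_atBot t).and (eventually_ge_atTop (-Real.log l))).exists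
  obtain ⟨x, hx, hxt⟩ := intermediate_value_Icc' hbc (continuous_realMap l).continuousOn
    ⟨hb, ht.trans (realMap_critPoint hl0).ge⟩
  exact ⟨x, hx.1, hxt⟩

/-- The holomorphic branch of `√(g - v)` on the strip, where `g` is the centred map and `v` its
critical value: the principal branch on the upper half, its negative on the lower half, and on the
real axis the common boundary values, which are purely imaginary. -/
noncomputable def sqrtMap (l : ℝ) (z : ℂ) : ℂ :=
  if 0 < z.im then Complex.sqrt (centredMap l z - critValue l)
  else if z.im < 0 then -Complex.sqrt (centredMap l z - critValue l)
  else if z.re ≤ -Real.log l then Complex.I * Complex.sqrt (-(centredMap l z - critValue l))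
  else -(Complex.I * Complex.sqrt (-(centredMap l z - critValue l)))

lemma sqrtMap_sq (l : ℝ) (z : ℂ) : sqrtMap l z ^ 2 = centredMap l z - critValue l := by
  unfold sqrtMap
  split_ifs <;> simp only [neg_sq, mul_pow, sqrt_sq, Complex.I_sq] <;> ring

lemma sub_critValue_mem_slitPlane_of_im_neg {l : ℝ} (hl0 : 0 < l) {z : ℂ} (hz : z ∈ strip)
    (him : z.im < 0) : centredMap l z - critValue l ∈ Complex.slitPlane := by
  have hz' : |z.im| < Real.pi := hz
  rw [abs_lt] at hz'
  have h1 := sub_critValue_mem_slitPlane hl0 (z := starRingEnd ℂ z)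
    ⟨by simpa using him, by simp; linarith⟩
  rw [centredMap_conj, Complex.mem_slitPlane_iff] at h1
  rw [Complex.mem_slitPlane_iff]
  simpa using h1

lemma mem_upperStrip_of_im_pos {z : ℂ} (hz : z ∈ strip) (him : 0 < z.im) : z ∈ upperStrip :=
  ⟨him, (abs_lt.1 (show |z.im| < Real.pi from hz)).2⟩

lemma conj_mem_upperStrip_of_im_neg {z : ℂ} (hz : z ∈ strip) (him : z.im < 0) :
    starRingEnd ℂ z ∈ upperStrip :=
  ⟨by simpa using him, by
    have := (abs_lt.1 (show |z.im| < Real.pi from hz)).1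
    simp; linarith⟩

lemma centredMap_of_im_eq_zero {l : ℝ} {z : ℂ} (him : z.im = 0) :
    centredMap l z - critValue l = -((critValue l - realMap l z.re : ℝ) : ℂ) := by
  have hz : z = (z.re : ℂ) := Complex.ext rfl (by simpa using him)
  conv_lhs => rw [hz, centredMap_ofReal]
  rw [realMap]; push_cast; ring

lemma sqrtMap_re_pos {l : ℝ} (hl0 : 0 < l) {z : ℂ} (hz : z ∈ strip) (him : 0 < z.im) :
    0 < (sqrtMap l z).re := by
  rw [sqrtMap, if_pos him]
  exact sqrt_re_pos (sub_critValue_mem_slitPlane hl0 (mem_upperStrip_of_im_pos hz him))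

lemma sqrtMap_re_neg {l : ℝ} (hl0 : 0 < l) {z : ℂ} (hz : z ∈ strip) (him : z.im < 0) :
    (sqrtMap l z).re < 0 := by
  rw [sqrtMap, if_neg him.le.not_gt, if_pos him, Complex.neg_re, neg_neg_iff_pos]
  exact sqrt_re_pos (sub_critValue_mem_slitPlane_of_im_neg hl0 hz him)

lemma sqrtMap_of_im_eq_zero {l : ℝ} (hl0 : 0 < l) {z : ℂ} (him : z.im = 0) :
    sqrtMap l z = (if z.re ≤ -Real.log l then 1 else -1) *
      (Real.sqrt (critValue l - realMap l z.re) : ℂ) * Complex.I := by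
  have h0 : 0 ≤ critValue l - realMap l z.re := sub_nonneg.2 (realMap_le_critValue hl0 _)
  have h1 : Complex.sqrt (-(centredMap l z - critValue l)) =
      (Real.sqrt (critValue l - realMap l z.re) : ℂ) := by
    rw [centredMap_of_im_eq_zero him, neg_neg, Complex.sqrt_of_nonneg]
    · simp
    · exact_mod_cast h0
  rw [sqrtMap, if_neg (by rw [him]; exact lt_irrefl _), if_neg (by rw [him]; exact lt_irrefl _), h1]
  split_ifs <;> ring

lemma sqrtMap_re_eq_zero {l : ℝ} (hl0 : 0 < l) {z : ℂ} (him : z.im = 0) :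
    (sqrtMap l z).re = 0 := by
  rw [sqrtMap_of_im_eq_zero hl0 him]
  split_ifs <;> simp

lemma injOn_sqrtMap {l : ℝ} (hl0 : 0 < l) : InjOn (sqrtMap l) strip := by
  intro z hz w hw h
  have hg : centredMap l z = centredMap l w := by
    have := congrArg (· ^ 2) h
    simp only [sqrtMap_sq] at this
    simpa using this
  rcases lt_trichotomy z.im 0 with hz0 | hz0 | hz0
  · rcases lt_trichotomy w.im 0 with hw0 | hw0 | hw0
    · have := injOn_centredMap_upperStrip hl0 (conj_mem_upperStrip_of_im_neg hz hz0)
        (conj_mem_upperStrip_of_im_neg hw hw0) (by rw [centredMap_conj, centredMap_conj, hg])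
      exact (starRingEnd ℂ).injective this
    · have h1 := sqrtMap_re_neg hl0 hz hz0
      rw [h, sqrtMap_re_eq_zero hl0 hw0] at h1
      exact absurd h1 (lt_irrefl _)
    · have h1 := sqrtMap_re_neg hl0 hz hz0
      rw [h] at h1
      exact absurd h1 (sqrtMap_re_pos hl0 hw hw0).not_gt
  · have h1 := sqrtMap_re_eq_zero hl0 hz0
    rcases lt_trichotomy w.im 0 with hw0 | hw0 | hw0
    · have h2 := sqrtMap_re_neg hl0 hw hw0
      rw [← h, h1] at h2
      exact absurd h2 (lt_irrefl _)
    · have hr : realMap l z.re = realMap l w.re := by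
        have h2 := centredMap_of_im_eq_zero (l := l) hz0
        rw [hg, centredMap_of_im_eq_zero hw0, neg_inj, Complex.ofReal_inj] at h2
        linarith
      have him := congrArg Complex.im h
      rw [sqrtMap_of_im_eq_zero hl0 hz0, sqrtMap_of_im_eq_zero hl0 hw0, hr] at him
      have hcrit : ∀ x, -Real.log l < x → 0 < Real.sqrt (critValue l - realMap l x) := fun x hx =>
        Real.sqrt_pos.2 (sub_pos.2 (realMap_lt_critValue hl0 hx.ne'))
      refine Complex.ext ?_ (hz0.trans hw0.symm)
      split_ifs at him with hzc hwc hwc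
      · exact (strictMonoOn_realMap hl0).injOn hzc hwc hr
      · have := hcrit _ (not_le.1 hwc)
        simp at him
        linarith
      · have := hcrit _ (not_le.1 hzc)
        rw [hr] at this
        simp at him
        linarith
      · exact (strictAntiOn_realMap hl0).injOn (not_le.1 hzc).le (not_le.1 hwc).le hr
    · have h2 := sqrtMap_re_pos hl0 hw hw0
      rw [← h, h1] at h2
      exact absurd h2 (lt_irrefl _)
  · rcases lt_trichotomy w.im 0 with hw0 | hw0 | hw0
    · have h1 := sqrtMap_re_pos hl0 hz hz0
      rw [h] at h1
      exact absurd h1 (sqrtMap_re_neg hl0 hw hw0).not_gt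
    · have h1 := sqrtMap_re_pos hl0 hz hz0
      rw [h, sqrtMap_re_eq_zero hl0 hw0] at h1
      exact absurd h1 (lt_irrefl _)
    · exact injOn_centredMap_upperStrip hl0 (mem_upperStrip_of_im_pos hz hz0)
        (mem_upperStrip_of_im_pos hw hw0) hg

/-- Away from the critical point `sqrtMap` is locally one of the four expressions `±√(g - v)`,
`±i√(v - g)`. -/
lemma differentiableAt_sqrtMap_of_ne {l : ℝ} (hl0 : 0 < l) {z : ℂ} (hz : z ∈ strip)
    (hne : z ≠ (-Real.log l : ℝ)) : DifferentiableAt ℂ (sqrtMap l) z := by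
  have hg : DifferentiableAt ℂ (fun z => centredMap l z - critValue l) z :=
    (differentiable_centredMap l z).sub_const _
  rcases lt_trichotomy z.im 0 with hz0 | hz0 | hz0
  · have h1 : DifferentiableAt ℂ (fun z => -Complex.sqrt (centredMap l z - critValue l)) z :=
      ((Complex.differentiableAt_sqrt
        (sub_critValue_mem_slitPlane_of_im_neg hl0 hz hz0)).comp z hg).neg
    refine h1.congr_of_eventuallyEq ?_
    filter_upwards [(isOpen_lt Complex.continuous_im continuous_const).mem_nhds hz0] with w hw
    have hw' : w.im < 0 := hw
    rw [sqrtMap, if_neg hw'.le.not_gt, if_pos hw']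
  · have hre : z.re ≠ -Real.log l := fun h =>
      hne (Complex.ext (by simpa using h) (by simpa using hz0))
    have hlt := realMap_lt_critValue hl0 hre
    have hpos : 0 < (-(centredMap l z - critValue l)).re := by
      rw [centredMap_of_im_eq_zero hz0, neg_neg, Complex.ofReal_re]
      linarith
    have h1 : DifferentiableAt ℂ
        (fun z => Complex.I * Complex.sqrt (-(centredMap l z - critValue l))) z :=
      ((Complex.differentiableAt_sqrt (Or.inl hpos)).comp z hg.neg).const_mul _
    have hexp := Real.exp_pos z.re
    -- the imaginary part `v - λ e^x sin v` has the sign of `v (1 - λ e^x)` for small `v`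
    have hsign : ∀ᶠ w : ℂ in 𝓝 z, w.im ≠ 0 →
        0 < (1 - l * Real.exp z.re) * (w.im * (centredMap l w).im) := by
      have hcrit : 1 - l * Real.exp z.re ≠ 0 := by
        intro h0
        apply hre
        have h2 : Real.exp z.re = l⁻¹ := by field_simp; linarith
        rw [← Real.log_exp z.re, h2, Real.log_inv]
      have hsinc : Continuous fun w : ℂ => 1 - l * Real.exp w.re * Real.sinc w.im := by
        have := Real.continuous_sinc
        fun_prop
      have hval : 0 < (1 - l * Real.exp z.re) *
          (1 - l * Real.exp z.re * Real.sinc z.im) := by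
        rw [hz0, Real.sinc_zero, mul_one]
        exact mul_self_pos.2 hcrit
      filter_upwards [(continuous_const.mul hsinc).continuousAt.eventually (lt_mem_nhds hval)]
        with w hw hw0
      have h3 : w.im * (centredMap l w).im =
          w.im ^ 2 * (1 - l * Real.exp w.re * Real.sinc w.im) := by
        rw [centredMap_im, Real.sinc_of_ne_zero hw0]
        field_simp
      rw [h3, mul_left_comm]
      exact mul_pos (by positivity) hw
    rcases lt_or_gt_of_ne hre with hlt' | hgt
    · have hc : 0 < 1 - l * Real.exp z.re := by
        have h4 := mul_lt_mul_of_pos_left (Real.exp_lt_exp.2 hlt') hl0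
        rw [Real.exp_neg, Real.exp_log hl0, mul_inv_cancel₀ hl0.ne'] at h4
        linarith
      refine h1.congr_of_eventuallyEq ?_
      filter_upwards [hsign, (isOpen_lt Complex.continuous_re continuous_const).mem_nhds hlt']
        with w hw hwre
      have hwre' : w.re < -Real.log l := hwre
      unfold sqrtMap
      split_ifs with h5 h6 h7
      · refine sqrt_eq_I_mul_of_im_pos ?_
        have := pos_of_mul_pos_right (hw h5.ne') hc.le
        simpa using pos_of_mul_pos_right this h5.le
      · rw [sqrt_eq_neg_I_mul_of_im_neg, neg_neg]
        have := pos_of_mul_pos_right (hw h6.ne) hc.le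
        simpa using neg_of_mul_pos_right this h6.le
      · rfl
      · exact absurd hwre'.le h7
    · have hc : 1 - l * Real.exp z.re < 0 := by
        have h4 := mul_lt_mul_of_pos_left (Real.exp_lt_exp.2 hgt) hl0
        rw [Real.exp_neg, Real.exp_log hl0, mul_inv_cancel₀ hl0.ne'] at h4
        linarith
      refine h1.neg.congr_of_eventuallyEq ?_
      filter_upwards [hsign, (isOpen_lt continuous_const Complex.continuous_re).mem_nhds hgt]
        with w hw hwre
      have hwre' : -Real.log l < w.re := hwre
      simp only [Pi.neg_apply]
      unfold sqrtMap
      split_ifs with h5 h6 h7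
      · refine sqrt_eq_neg_I_mul_of_im_neg ?_
        have := neg_of_mul_pos_right (hw h5.ne') hc.le
        simpa using neg_of_mul_neg_right this h5.le
      · rw [sqrt_eq_I_mul_of_im_pos]
        have := neg_of_mul_pos_right (hw h6.ne) hc.le
        simpa using pos_of_mul_neg_right this h6.le
      · exact absurd hwre' h7.not_gt
      · rfl
  · have h1 := (Complex.differentiableAt_sqrt
      (sub_critValue_mem_slitPlane hl0 (mem_upperStrip_of_im_pos hz hz0))).comp z hg
    refine h1.congr_of_eventuallyEq ?_
    filter_upwards [(isOpen_lt continuous_const Complex.continuous_im).mem_nhds hz0] with w hw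
    have hw' : 0 < w.im := hw
    rw [sqrtMap, if_pos hw', Function.comp_apply]

lemma differentiableOn_sqrtMap {l : ℝ} (hl0 : 0 < l) : DifferentiableOn ℂ (sqrtMap l) strip := by
  intro z hz
  by_cases hne : z = (-Real.log l : ℝ)
  · -- at the critical point `sqrtMap` is continuous, hence the singularity is removable
    refine (Complex.analyticAt_of_differentiable_on_punctured_nhds_of_continuousAt
      ?_ ?_).differentiableAt.differentiableWithinAt
    · rw [eventually_nhdsWithin_iff]
      filter_upwards [isOpen_strip.mem_nhds hz] with w hw hwz
      exact differentiableAt_sqrtMap_of_ne hl0 hw (fun h => hwz (h.trans hne.symm))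
    · have hval : centredMap l z - critValue l = 0 := by
        rw [hne, centredMap_ofReal, ← realMap_critPoint hl0, realMap, sub_self]
      have h0 : sqrtMap l z = 0 := by
        rw [← sq_eq_zero_iff, sqrtMap_sq, hval]
      rw [ContinuousAt, h0, tendsto_zero_iff_norm_tendsto_zero]
      have h1 : Tendsto (fun w => Real.sqrt ‖centredMap l w - critValue l‖) (𝓝 z) (𝓝 0) := by
        have hc : Continuous fun w => Real.sqrt ‖centredMap l w - critValue l‖ := by
          have := continuous_centredMap l
          fun_prop
        exact hc.tendsto' _ _ (by rw [hval]; simp)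
      refine h1.congr fun w => ?_
      rw [← sqrtMap_sq, norm_pow, Real.sqrt_sq (norm_nonneg _)]
  · exact (differentiableAt_sqrtMap_of_ne hl0 hz hne).differentiableWithinAt

lemma conj_mem_strip {z : ℂ} (hz : z ∈ strip) : starRingEnd ℂ z ∈ strip := by
  have hz' : |z.im| < Real.pi := hz
  simpa [strip] using hz'

/-- The square root map takes every value whose square lies in the strip, moved by the critical
value. -/
lemma exists_sqrtMap_eq {l : ℝ} (hl0 : 0 < l) {u : ℂ} (hu : u ^ 2 + critValue l ∈ strip) :
    ∃ z ∈ strip, sqrtMap l z = u := by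
  have hsub : ∀ {z : ℂ}, z ∈ upperStrip → z ∈ strip := fun {z} hz =>
    show |z.im| < Real.pi by rw [abs_of_pos hz.1]; exact hz.2
  have hslit : u.re ≠ 0 → u ^ 2 ∈ Complex.slitPlane := by
    intro h
    rw [Complex.mem_slitPlane_iff, sq, Complex.mul_re, Complex.mul_im]
    by_cases him : u.im = 0
    · left
      rw [him]
      have : 0 < u.re * u.re := mul_self_pos.2 h
      linarith
    · right
      have := mul_ne_zero h him
      intro h0
      apply this
      linarith
  rcases lt_trichotomy u.re 0 with h | h | h
  · obtain ⟨z, hz, hzt⟩ := exists_mem_upperStrip_centredMap_eq hl0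
      (t := starRingEnd ℂ (u ^ 2 + critValue l))
      (conj_mem_strip hu)
      (by
        have := hslit h.ne
        rw [map_add, Complex.conj_ofReal, add_sub_cancel_right]
        rw [Complex.mem_slitPlane_iff] at this ⊢
        rwa [Complex.conj_re, Complex.conj_im, neg_ne_zero])
    have hz' : starRingEnd ℂ z ∈ strip := conj_mem_strip (hsub hz)
    refine ⟨starRingEnd ℂ z, hz', ?_⟩
    have h1 : (-sqrtMap l (starRingEnd ℂ z)) ^ 2 = (-u) ^ 2 := by
      rw [neg_sq, sqrtMap_sq, centredMap_conj, hzt, Complex.conj_conj]; ring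
    have h2 := eq_of_sq_eq_of_re_pos h1
      (by
        rw [Complex.neg_re, neg_pos]
        exact sqrtMap_re_neg hl0 hz' (by rw [Complex.conj_im]; linarith [hz.1]))
      (by rw [Complex.neg_re]; linarith)
    exact neg_inj.1 h2
  · have hu2 : u ^ 2 = -((u.im ^ 2 : ℝ) : ℂ) := by
      rw [show u = u.im * Complex.I from Complex.ext (by simp [h]) (by simp), mul_pow,
        Complex.I_sq]
      simp
    have hle : critValue l - u.im ^ 2 ≤ critValue l := by nlinarith [sq_nonneg u.im]
    rcases le_or_gt 0 u.im with him | him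
    · obtain ⟨x, hx, hxt⟩ := exists_le_realMap_eq hl0 hle
      refine ⟨x, by simp [strip, Real.pi_pos], ?_⟩
      rw [sqrtMap_of_im_eq_zero hl0 (Complex.ofReal_im x), Complex.ofReal_re, if_pos hx, hxt,
        sub_sub_cancel, Real.sqrt_sq him]
      exact Complex.ext (by simp [h]) (by simp)
    · obtain ⟨x, hx, hxt⟩ := exists_ge_realMap_eq hl0 hle
      have hne : ¬ x ≤ -Real.log l := by
        intro hle'
        rw [le_antisymm hle' hx, realMap_critPoint hl0] at hxt
        have : 0 < u.im ^ 2 := by nlinarith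
        linarith
      refine ⟨x, by simp [strip, Real.pi_pos], ?_⟩
      rw [sqrtMap_of_im_eq_zero hl0 (Complex.ofReal_im x), Complex.ofReal_re, if_neg hne, hxt,
        sub_sub_cancel, Real.sqrt_sq_eq_abs, abs_of_neg him]
      exact Complex.ext (by simp [h]) (by simp)
  · obtain ⟨z, hz, hzt⟩ := exists_mem_upperStrip_centredMap_eq hl0 hu
      (by rw [add_sub_cancel_right]; exact hslit h.ne')
    refine ⟨z, hsub hz, eq_of_sq_eq_of_re_pos ?_ (sqrtMap_re_pos hl0 (hsub hz) hz.1) h⟩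
    rw [sqrtMap_sq, hzt]; ring

/-! ### The immediate basin is an increasing union of conformal discs -/

lemma IsConformalDisc.strip_inter_preimage_sqrtMap {l : ℝ} (hl0 : 0 < l) {W : Set ℂ}
    (hW : IsConformalDisc W) (hsub : W ⊆ sqrtMap l '' strip) :
    IsConformalDisc (strip ∩ sqrtMap l ⁻¹' W) := by
  have hinj := injOn_sqrtMap hl0
  have hd := differentiableOn_sqrtMap hl0
  have heq : strip ∩ sqrtMap l ⁻¹' W = Function.invFunOn (sqrtMap l) strip '' W := by
    ext z
    constructor
    · rintro ⟨hz, hzW⟩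
      exact ⟨sqrtMap l z, hzW, hinj.leftInvOn_invFunOn hz⟩
    · rintro ⟨w, hw, rfl⟩
      refine ⟨Function.invFunOn_mem (hsub hw), ?_⟩
      rwa [mem_preimage, Function.invFunOn_eq (hsub hw)]
  rw [heq]
  refine hW.image (fun w hw => ?_) fun w hw w' hw' h => ?_
  · obtain ⟨z, hz, rfl⟩ := hsub hw
    exact (differentiableAt_invFunOn isOpen_strip hd hinj hz).differentiableWithinAt
  · rw [← Function.invFunOn_eq (hsub hw), h, Function.invFunOn_eq (hsub hw')]

lemma connectedComponentIn_eq_of_disjoint_union {X : Type*} [TopologicalSpace X] {A B E : Set X}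
    {x : X} (hE : E = A ∪ B) (hAo : IsOpen A) (hBo : IsOpen B) (hAB : Disjoint A B)
    (hA : IsPreconnected A) (hx : x ∈ A) : connectedComponentIn E x = A := by
  have hxE : x ∈ E := hE ▸ Or.inl hx
  refine Subset.antisymm ?_ (hA.subset_connectedComponentIn hx (hE ▸ subset_union_left))
  exact isPreconnected_connectedComponentIn.subset_left_of_subset_union hAo hBo hAB
    ((connectedComponentIn_subset E x).trans hE.subset) ⟨x, mem_connectedComponentIn hxE, hx⟩

/-- Pulling back a conformal disc by the centred map, and taking the component at the fixed point,
gives a conformal disc: the map is a double cover of the strip by `strip ∩ g⁻¹(strip)`, which is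
branched over the critical value only. -/
lemma IsConformalDisc.connectedComponentIn_preimage {l : ℝ} (hl0 : 0 < l) {V : Set ℂ}
    (hV : IsConformalDisc V) (hVs : V ⊆ strip) (h0 : (0 : ℂ) ∈ V) :
    IsConformalDisc (connectedComponentIn (strip ∩ centredMap l ⁻¹' V) 0) := by
  set V' : Set ℂ := (fun z => z - critValue l) '' V
  have hV' : IsConformalDisc V' := hV.image (by fun_prop) (fun z _ w _ h => by simpa using h)
  have hmem : ∀ t : ℂ, t ∈ V' ↔ t + critValue l ∈ V := by
    intro t
    constructor
    · rintro ⟨z, hz, rfl⟩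
      simpa using hz
    · intro ht
      exact ⟨_, ht, by simp⟩
  have hE : strip ∩ centredMap l ⁻¹' V = strip ∩ sqrtMap l ⁻¹' {u | u ^ 2 ∈ V'} := by
    ext z
    simp only [mem_inter_iff, mem_preimage, mem_ofPred_eq, hmem, sqrtMap_sq, sub_add_cancel]
  have hsurj : {u : ℂ | u ^ 2 ∈ V'} ⊆ sqrtMap l '' strip := by
    intro u hu
    exact exists_sqrtMap_eq hl0 (hVs ((hmem _).1 hu))
  have h0E : (0 : ℂ) ∈ strip ∩ centredMap l ⁻¹' V :=
    ⟨zero_mem_strip, by rwa [mem_preimage, centredMap_zero]⟩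
  by_cases hc : (0 : ℂ) ∈ V'
  · have hdisc := (hV'.preimage_sq hc).strip_inter_preimage_sqrtMap hl0 hsurj
    rw [← hE] at hdisc
    rw [hdisc.isPreconnected.connectedComponentIn h0E]
    exact hdisc
  · obtain ⟨W, hW, hdisj, hWeq⟩ := hV'.exists_sqrt hc
    rw [hWeq] at hsurj hE
    have hW' : IsConformalDisc (-W) := by
      rw [← image_neg_eq_neg]
      exact hW.image (by fun_prop) neg_injective.injOn
    have h1 := hW.strip_inter_preimage_sqrtMap hl0 (subset_union_left.trans hsurj)
    have h2 := hW'.strip_inter_preimage_sqrtMap hl0 (subset_union_right.trans hsurj)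
    have hd12 : Disjoint (strip ∩ sqrtMap l ⁻¹' W) (strip ∩ sqrtMap l ⁻¹' (-W)) :=
      (hdisj.preimage _).mono inter_subset_right inter_subset_right
    have hEu : strip ∩ centredMap l ⁻¹' V =
        (strip ∩ sqrtMap l ⁻¹' W) ∪ (strip ∩ sqrtMap l ⁻¹' (-W)) := by
      rw [hE, preimage_union, inter_union_distrib_left]
    rcases hEu ▸ h0E with h0W | h0W
    · rw [connectedComponentIn_eq_of_disjoint_union hEu h1.isOpen h2.isOpen hd12
        h1.isPreconnected h0W]
      exact h1
    · rw [connectedComponentIn_eq_of_disjoint_union (hEu.trans (union_comm _ _)) h2.isOpen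
        h1.isOpen hd12.symm h2.isPreconnected h0W]
      exact h2

/-- The successive pull-backs of the disc of radius `r` at the fixed point `0` along the orbit of
this point. -/
def basinExhaustion (l r : ℝ) : ℕ → Set ℂ
  | 0 => Metric.ball 0 r
  | n + 1 => connectedComponentIn (strip ∩ centredMap l ⁻¹' basinExhaustion l r n) 0

lemma basinExhaustion_subset_strip {l r : ℝ} (hrπ : r < Real.pi) (n : ℕ) :
    basinExhaustion l r n ⊆ strip := by
  cases n with
  | zero =>
    intro z hz
    rw [basinExhaustion, mem_ball_zero_iff] at hz
    exact (Complex.abs_im_le_norm z).trans_lt (hz.trans hrπ)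
  | succ n => exact (connectedComponentIn_subset _ _).trans inter_subset_left

lemma zero_mem_basinExhaustion {l r : ℝ} (hr : 0 < r) (n : ℕ) :
    (0 : ℂ) ∈ basinExhaustion l r n := by
  induction n with
  | zero => exact Metric.mem_ball_self hr
  | succ n ih =>
    exact mem_connectedComponentIn ⟨zero_mem_strip, by rwa [mem_preimage, centredMap_zero]⟩

lemma isConformalDisc_basinExhaustion {l r : ℝ} (hl0 : 0 < l) (hr : 0 < r) (hrπ : r < Real.pi)
    (n : ℕ) : IsConformalDisc (basinExhaustion l r n) := by
  induction n with
  | zero => exact isConformalDisc_ball 0 hr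
  | succ n ih =>
    exact ih.connectedComponentIn_preimage hl0 (basinExhaustion_subset_strip hrπ n)
      (zero_mem_basinExhaustion hr n)

lemma monotone_basinExhaustion {l r : ℝ} (hr : 0 < r) (hrπ : r < Real.pi)
    (hm : MapsTo (centredMap l) (Metric.ball 0 r) (Metric.ball 0 r)) :
    Monotone (basinExhaustion l r) := by
  refine monotone_nat_of_le_succ fun n => ?_
  induction n with
  | zero =>
    exact (convex_ball (0 : ℂ) r).isPreconnected.subset_connectedComponentIn
      (Metric.mem_ball_self hr) (subset_inter (basinExhaustion_subset_strip (l := l) hrπ 0) hm)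
  | succ n ih =>
    exact connectedComponentIn_mono 0 (inter_subset_inter_right _ (preimage_mono ih))

lemma subset_basinExhaustion {l r : ℝ} (hl0 : 0 < l) (n : ℕ) :
    ∀ K : Set ℂ, IsPreconnected K → (0 : ℂ) ∈ K → K ⊆ centredImmediateBasin l →
      MapsTo (centredMap l)^[n] K (Metric.ball 0 r) → K ⊆ basinExhaustion l r n := by
  induction n with
  | zero => exact fun K _ _ _ h => h
  | succ n ih =>
    intro K hK h0 hKA hmaps
    have h1 := ih (centredMap l '' K) (hK.image _ (continuous_centredMap l).continuousOn)
      ⟨0, h0, centredMap_zero l⟩ ((mapsTo_centredImmediateBasin l).mono_left hKA).image_subset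
      (by rintro _ ⟨z, hz, rfl⟩; exact hmaps hz)
    exact hK.subset_connectedComponentIn h0
      (subset_inter (hKA.trans (centredImmediateBasin_subset_strip hl0)) (image_subset_iff.1 h1))

lemma iUnion_basinExhaustion {l q r : ℝ} (hl0 : 0 < l) (hl2 : l < 2) (hq0 : 0 ≤ q) (hq1 : q < 1)
    (hr : 0 < r) (hrπ : r < Real.pi)
    (hcon : ∀ z ∈ Metric.ball (0 : ℂ) r, ‖centredMap l z‖ ≤ q * ‖z‖) :
    ⋃ n, basinExhaustion l r n = centredImmediateBasin l := by
  have hm := mapsTo_ball_of_contracting hq1 hcon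
  refine Subset.antisymm (iUnion_subset fun n => ?_) fun z hz => ?_
  · refine subset_centredImmediateBasin
      (isConformalDisc_basinExhaustion hl0 hr hrπ n).isPreconnected
      (zero_mem_basinExhaustion hr n) ?_
    induction n with
    | zero => exact ball_subset_centredBasin hq0 hq1 hcon
    | succ n ih =>
      intro z hz
      exact mem_centredBasin_of_iterate_mem 1 (ih (connectedComponentIn_subset _ _ hz).2)
  · have hpath : IsPathConnected (centredImmediateBasin l) :=
      (isOpen_centredImmediateBasin hl0 hl2).isConnected_iff_isPathConnected.1
        ⟨⟨0, zero_mem_centredImmediateBasin l⟩, isPreconnected_centredImmediateBasin l⟩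
    obtain ⟨γ, hγ⟩ := hpath.joinedIn 0 (zero_mem_centredImmediateBasin l) z hz
    -- the path from `0` to `z` is compact, so a single iterate maps it into the small disc
    have hdir : Monotone fun n : ℕ => (centredMap l)^[n] ⁻¹' Metric.ball 0 r := by
      refine monotone_nat_of_le_succ fun n w hw => ?_
      rw [mem_preimage, Function.iterate_succ_apply']
      exact hm hw
    obtain ⟨n, hn⟩ := (isCompact_range γ.continuous).elim_directed_cover _
      (fun n => Metric.isOpen_ball.preimage (continuous_iterate_centredMap l n))
      (by
        rintro _ ⟨t, rfl⟩
        exact mem_iUnion.2 (exists_iterate_mem_ball hr (centredImmediateBasin_subset l (hγ t))))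
      hdir.directed_le
    refine mem_iUnion.2 ⟨n, subset_basinExhaustion hl0 n (range γ)
      (isPreconnected_range γ.continuous) ⟨0, γ.source⟩ ?_ hn ⟨1, γ.target⟩⟩
    rintro _ ⟨t, rfl⟩
    exact hγ t

lemma isSimplyConnected_immediateBasin {l : ℝ} (hl0 : 0 < l) (hl2 : l < 2) (k : ℤ) :
    IsSimplyConnected (immediateBasin (fMap l) (fixedPt k)) := by
  obtain ⟨q, r, hq0, hq1, hr, hrπ, hcon⟩ := exists_contracting_ball hl0 hl2
  have h1 := isSimplyConnected_iUnion_of_monotone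
    (monotone_basinExhaustion hr hrπ (mapsTo_ball_of_contracting hq1 hcon))
    (fun n => (isConformalDisc_basinExhaustion hl0 hr hrπ n).isOpen)
    (fun n => (isConformalDisc_basinExhaustion hl0 hr hrπ n).isSimplyConnected)
  rw [iUnion_basinExhaustion hl0 hl2 hq0 hq1 hr hrπ hcon] at h1
  rw [immediateBasin_fMap]
  exact (Homeomorph.addLeft (fixedPt k)).isSimplyConnected_image.2 h1

end EntireDynamics

theorem mainTheorem6 (l : ℝ) (hl0 : 0 < l) (hl2 : l < 2) :
    (∀ k : ℤ,
      EntireDynamics.IsWanderingDomain (EntireDynamics.FMap l)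
        (EntireDynamics.immediateBasin (EntireDynamics.fMap l)
          ((2 * k + 1) * Real.pi * Complex.I)) ∧
      IsSimplyConnected
        (EntireDynamics.immediateBasin (EntireDynamics.fMap l)
          ((2 * k + 1) * Real.pi * Complex.I)) ∧
      ¬ Bornology.IsBounded
        (EntireDynamics.immediateBasin (EntireDynamics.fMap l)
          ((2 * k + 1) * Real.pi * Complex.I)) ∧
      EntireDynamics.IsEscaping (EntireDynamics.FMap l)
        (EntireDynamics.immediateBasin (EntireDynamics.fMap l)
          ((2 * k + 1) * Real.pi * Complex.I))) ∧
    ¬ ∃ D : Set ℂ, EntireDynamics.IsBakerWanderingDomain (EntireDynamics.FMap l) D :=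
  ⟨fun k => ⟨EntireDynamics.isWanderingDomain_immediateBasin hl0 hl2 k,
    EntireDynamics.isSimplyConnected_immediateBasin hl0 hl2 k,
    EntireDynamics.not_isBounded_immediateBasin hl0 hl2 k,
    EntireDynamics.isEscaping_immediateBasin l k⟩,
  fun ⟨D, hD⟩ => EntireDynamics.not_isBakerWanderingDomain_FMap hl0 hl2 D hD⟩
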